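/- Let $X$ be a complex manifold of dimension $n$, with structure sheaf $\mathcal O_X$, sheaf of holomorphic vector fields $\Theta_X$ and sheaf of holomorphic differential operators $\mathcal D_X$. For a vector field $v$ let $\sigma(v)$ be its symbol, the holomorphic function $(x,\xi)\mapsto\langle \xi, v(x)\rangle$ on $T^*X$. Let $\mathcal I\subset\Theta_X$ be a coherent $\mathcal O_X$-submodule which is a Lie subalgebra of $\Theta_X$. Let $U\subset X$ be open and let $v_1,\dots,v_r\in\mathcal I(U)$ generate $\mathcal I|_U$ as an $\mathcal O_U$-module and satisfy $[v_i,v_j]=0$ for all $i,j$. We say that - $\sigma(v_1),\dots,\sigma(v_r)$ is a regular sequence in $\mathcal O_{T^*X}$ (over $U$) if for all $0\le d<r$ and all $p\in T^*X$ above $U$, multiplication by $\sigma(v_{d+1})$ is injective on $\mathcal O_{T^*X,p}/\sum_{j\le d}\mathcal O_{T^*X,p}\,\sigma(v_j)$; - $v_1,\dots,v_r$ is a regular sequence in $\mathcal D_X$ (over $U$) if for all $0\le d<r$ and all $x\in U$, right multiplication $P\mapsto P v_{d+1}$ is injective on $\mathcal D_{X,x}/\sum_{j\le d}\mathcal D_{X,x}\,v_j$.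 Then, for every such $U$ and $(v_1,\dots,v_r)$: if $\sigma(v_1),\dots,\sigma(v_r)$ is a regular sequence in $\mathcal O_{T^*X}$, then $v_1,\dots,v_r$ is a regular sequence in $\mathcal D_X$. Consequently hypothesis (2) implies hypothesis (3), where (2) every point of $X$ has an open neighbourhood $U$ on which there are $r\ge 0$ and $v_1,\dots,v_r\in\mathcal I(U)$ generating $\mathcal I|_U$, with $[v_i,v_j]=0$ for all $i,j$, such that $\sigma(v_1),\dots,\sigma(v_r)$ is a regular sequence in $\mathcal O_{T^*X}$; (3) every point of $X$ has an open neighbourhood $U$ on which there are $r\ge 0$ and $v_1,\dots,v_r\in\mathcal I(U)$ generating $\mathcal I|_U$, with $[v_i,v_j]=0$ for all $i,j$, such that $v_1,\dots,v_r$ is a regular sequence in $\mathcal D_X$. -/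

import Mathlib

open Set Filter Topology
open scoped Manifold ContDiff Bundle

noncomputable section

namespace HolFoliation

/-! ### Germs of holomorphic functions -/

section Functions

variable {E H M : Type*} [NormedAddCommGroup E] [NormedSpace ℂ E] [TopologicalSpace H]
  [TopologicalSpace M] [ChartedSpace H M]

/-- Germs of complex functions along a filter form a complex algebra. -/
instance germAlgebra {α : Type*} (l : Filter α) : Algebra ℂ (Germ l ℂ) :=
  Algebra.ofModule
    (fun c a b => by
      induction a using Germ.inductionOn with | _ f =>
      induction b using Germ.inductionOn with | _ g =>
      exact congrArg (fun h : α → ℂ => (h : Germ l ℂ)) (smul_mul_assoc c f g))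
    (fun c a b => by
      induction a using Germ.inductionOn with | _ f =>
      induction b using Germ.inductionOn with | _ g =>
      exact congrArg (fun h : α → ℂ => (h : Germ l ℂ)) (mul_smul_comm c f g))

/-- `f` is holomorphic (complex analytic) near the point `x` of the complex manifold `M`. -/
def HolFunAt (I : ModelWithCorners ℂ E H) (f : M → ℂ) (x : M) : Prop :=
  ContMDiffAt I 𝓘(ℂ, ℂ) ω f x

/-- The stalk `𝒪_{M,x}` of the structure sheaf of the complex manifold `M`: the algebra of germs
at `x` of functions that are holomorphic near `x`. -/
def Stalk (I : ModelWithCorners ℂ E H) (x : M) : Subalgebra ℂ (Germ (𝓝 x) ℂ) where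
  carrier := {g | ∃ f : M → ℂ, HolFunAt I f x ∧ (f : Germ (𝓝 x) ℂ) = g}
  mul_mem' := by
    rintro _ _ ⟨f, hf, rfl⟩ ⟨g, hg, rfl⟩
    exact ⟨f * g, ContMDiffAt.mul hf hg, rfl⟩
  add_mem' := by
    rintro _ _ ⟨f, hf, rfl⟩ ⟨g, hg, rfl⟩
    exact ⟨f + g, ContMDiffAt.add hf hg, rfl⟩
  algebraMap_mem' := fun c =>
    ⟨fun _ => c, contMDiffAt_const, by
      rw [Algebra.algebraMap_eq_smul_one]
      refine congrArg (fun h : M → ℂ => (h : Germ (𝓝 x) ℂ)) ?_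
      funext y
      simp⟩

/-- The germ at `x` of a function that is holomorphic near `x`. -/
def funGerm (I : ModelWithCorners ℂ E H) {x : M} (f : M → ℂ) (hf : HolFunAt I f x) : Stalk I x :=
  ⟨(f : Germ (𝓝 x) ℂ), f, hf, rfl⟩

end Functions

/-! ### Vector fields, differential operators and symbols -/

section VectorFields

variable {E X : Type*} [NormedAddCommGroup E] [NormedSpace ℂ E] [TopologicalSpace X]
  [ChartedSpace E X]

variable (E X) in
/-- Vector fields on `X`. They are only looked at on the open set on which they are required to be
holomorphic; the values elsewhere play no role. -/
abbrev VField : Type _ := (x : X) → TangentSpace 𝓘(ℂ, E) x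

/-- The derivative of the function `f` along the vector field `v`. -/
def lieDeriv (v : VField E X) (f : X → ℂ) : X → ℂ :=
  fun y => (mfderiv 𝓘(ℂ, E) 𝓘(ℂ, ℂ) f y (v y) : ℂ)

theorem lieDeriv_congr (v : VField E X) {f g : X → ℂ} {x : X} (h : f =ᶠ[𝓝 x] g) :
    lieDeriv v f =ᶠ[𝓝 x] lieDeriv v g := by
  filter_upwards [h.eventuallyEq_nhds] with y hy
  simp only [lieDeriv]
  rw [hy.mfderiv_eq]
  rfl

variable (E X) in
/-- The (total space of the) holomorphic cotangent bundle `T^*X`, with its standard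
structure of complex manifold. -/
abbrev Cotangent [IsManifold 𝓘(ℂ, E) ω X] : Type _ :=
  Bundle.TotalSpace (E →L[ℂ] ℂ) (fun x : X => TangentSpace 𝓘(ℂ, E) x →L[ℂ] Bundle.Trivial X ℂ x)

variable [IsManifold 𝓘(ℂ, E) ω X]

/-- `v` is a holomorphic vector field near `x`. -/
def HolVFieldAt (v : VField E X) (x : X) : Prop :=
  ContMDiffAt 𝓘(ℂ, E) 𝓘(ℂ, E).tangent ω
    (fun y => (⟨y, v y⟩ : TangentBundle 𝓘(ℂ, E) X)) x

theorem contMDiffAt_section {M : Type*} {E' H' : Type*} [NormedAddCommGroup E']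
    [NormedSpace ℂ E'] [TopologicalSpace H'] [TopologicalSpace M] [ChartedSpace H' M]
    {I' : ModelWithCorners ℂ E' H'} {f : M → ℂ} {g : M → ℂ} {p : M}
    (h : ContMDiffAt I' 𝓘(ℂ, ℂ).tangent ω
      (fun y => (⟨f y, g y⟩ : TangentBundle 𝓘(ℂ, ℂ) ℂ)) p) :
    ContMDiffAt I' 𝓘(ℂ, ℂ) ω g p :=
  (contMDiff_snd_tangentBundle_modelSpace ℂ 𝓘(ℂ, ℂ)).contMDiffAt.comp p h

/-- The derivative of a holomorphic function along a holomorphic vector field is holomorphic. -/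
theorem holFunAt_lieDeriv {v : VField E X} {f : X → ℂ} {x : X} (hv : HolVFieldAt v x)
    (hf : HolFunAt 𝓘(ℂ, E) f x) : HolFunAt 𝓘(ℂ, E) (lieDeriv v f) x := by
  apply contMDiffAt_section (f := f) (g := lieDeriv v f)
  exact ContMDiffAt.clm_apply_of_inCoordinates (B₁ := X) (B₂ := ℂ) (b₁ := id) (b₂ := f)
    (hf.mfderiv_const (m := ω) le_rfl) hv hf

theorem lieDeriv_add (v : VField E X) {f g : X → ℂ} {x : X} (hf : HolFunAt 𝓘(ℂ, E) f x)
    (hg : HolFunAt 𝓘(ℂ, E) g x) : lieDeriv v (f + g) =ᶠ[𝓝 x] lieDeriv v f + lieDeriv v g := by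
  filter_upwards [contMDiffAt_iff_contMDiffAt_nhds (by simp) |>.1 hf,
    contMDiffAt_iff_contMDiffAt_nhds (by simp) |>.1 hg]
    with y hy hy'
  simp only [lieDeriv, Pi.add_apply]
  rw [mfderiv_add (hy.mdifferentiableAt (by simp)) (hy'.mdifferentiableAt (by simp))]
  rfl

theorem lieDeriv_smul (v : VField E X) (c : ℂ) {f : X → ℂ} {x : X}
    (hf : HolFunAt 𝓘(ℂ, E) f x) : lieDeriv v (c • f) =ᶠ[𝓝 x] c • lieDeriv v f := by
  filter_upwards [contMDiffAt_iff_contMDiffAt_nhds (by simp) |>.1 hf] with y hy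
  simp only [lieDeriv, Pi.smul_apply]
  rw [const_smul_mfderiv (hy.mdifferentiableAt (by simp)) c]
  rfl

/-- The symbol of the vector field `v`: the function `(x, ξ) ↦ ⟨ξ, v(x)⟩` on `T^*X`. -/
def symbol (v : VField E X) : Cotangent E X → ℂ :=
  fun p => (p.2 (v p.1) : ℂ)

theorem holFunAt_symbol {v : VField E X} (p : Cotangent E X) (hv : HolVFieldAt v p.1) :
    HolFunAt (𝓘(ℂ, E).prod 𝓘(ℂ, E →L[ℂ] ℂ)) (symbol v) p := by
  have h1 : ContMDiffAt (𝓘(ℂ, E).prod 𝓘(ℂ, E →L[ℂ] ℂ)) 𝓘(ℂ, E) ω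
      (fun q : Cotangent E X => q.1) p :=
    Bundle.contMDiffAt_proj _
  have h2 := ContMDiffAt.comp p hv h1
  have h3 := ContMDiffAt.clm_bundle_apply (F₂ := ℂ) (E₂ := Bundle.Trivial X ℂ)
    (b := fun q : Cotangent E X => q.1) (ϕ := fun q : Cotangent E X => q.2)
    (v := fun q => v q.1) (contMDiffAt_id (x := p)) h2
  exact (Bundle.contMDiffAt_totalSpace.1 h3).2

/-- The action `f ↦ v(f)` of a germ of holomorphic vector field on `𝒪_{X,x}`. -/
def vfieldEnd {x : X} (v : VField E X) (hv : HolVFieldAt v x) :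
    Module.End ℂ (Stalk 𝓘(ℂ, E) x) where
  toFun g := ⟨Germ.map' (lieDeriv v) (fun _ _ h => lieDeriv_congr v h) g.1, by
    obtain ⟨_, f, hf, rfl⟩ := g
    exact ⟨lieDeriv v f, holFunAt_lieDeriv hv hf, rfl⟩⟩
  map_add' := by
    rintro ⟨_, f, hf, rfl⟩ ⟨_, g, hg, rfl⟩
    exact Subtype.ext (Germ.coe_eq.2 (lieDeriv_add v hf hg))
  map_smul' := by
    rintro c ⟨_, f, hf, rfl⟩
    exact Subtype.ext (Germ.coe_eq.2 (lieDeriv_smul v c hf))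

/-- The ring `𝒟_{X,x}` of germs at `x` of holomorphic differential operators: the algebra of
endomorphisms of `𝒪_{X,x}` generated by the multiplications by germs of holomorphic functions
and by the germs of holomorphic vector fields. -/
def DiffOp (x : X) : Subalgebra ℂ (Module.End ℂ (Stalk 𝓘(ℂ, E) x)) :=
  Algebra.adjoin ℂ
    (Set.range (fun f : Stalk 𝓘(ℂ, E) x => LinearMap.mulLeft ℂ f) ∪
      {T | ∃ (v : VField E X) (hv : HolVFieldAt v x), T = vfieldEnd v hv})

/-- A germ of holomorphic vector field, as an element of `𝒟_{X,x}`. -/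
def vfieldOp {x : X} (v : VField E X) (hv : HolVFieldAt v x) : DiffOp (E := E) x :=
  ⟨vfieldEnd v hv, Algebra.subset_adjoin (Or.inr ⟨v, hv, rfl⟩)⟩

/-- The symbols `σ(v_1), …, σ(v_r)` form a regular sequence in the sheaf `𝒪_{T^*X}` over `U`:
at each point `p` of `T^*X` above `U`, multiplication by `σ(v_d)` is injective on
`𝒪_{T^*X,p} / ∑_{j < d} 𝒪_{T^*X,p} σ(v_j)` for all `d`. -/
def SymbolsRegular (U : TopologicalSpace.Opens X) {r : ℕ} (v : Fin r → VField E X)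
    (hv : ∀ i, ∀ x ∈ U, HolVFieldAt (v i) x) : Prop :=
  ∀ (p : Cotangent E X) (hp : p.1 ∈ U),
    RingTheory.Sequence.IsWeaklyRegular (Stalk (𝓘(ℂ, E).prod 𝓘(ℂ, E →L[ℂ] ℂ)) p)
      (List.ofFn fun i => funGerm (𝓘(ℂ, E).prod 𝓘(ℂ, E →L[ℂ] ℂ)) (symbol (v i))
        (holFunAt_symbol p (hv i p.1 hp)))

/-- The commuting vector fields `v_1, …, v_r` form a regular sequence in the sheaf `𝒟_X` over `U`:
at each point `x` of `U`, right multiplication by `v_d` is injective on the quotient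
`𝒟_{X,x} / ∑_{j < d} 𝒟_{X,x} v_j` by a left ideal, for all `d`. (It acts on this quotient because
the `v_j` commute; `Ideal.span` in a noncommutative ring is the generated left ideal.) -/
def OperatorsRegular (U : TopologicalSpace.Opens X) {r : ℕ} (v : Fin r → VField E X)
    (hv : ∀ i, ∀ x ∈ U, HolVFieldAt (v i) x) : Prop :=
  ∀ (x : X) (hx : x ∈ U) (d : Fin r) (P : DiffOp (E := E) x),
    P * vfieldOp (v d) (hv d x hx) ∈
        Ideal.span ((fun j => vfieldOp (v j) (hv j x hx)) '' Set.Iio d) →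
      P ∈ Ideal.span ((fun j => vfieldOp (v j) (hv j x hx)) '' Set.Iio d)

/-! ### Submodules of the sheaf of vector fields -/

variable (E X) in
/-- An `𝒪_X`-submodule (subsheaf) of the sheaf `Θ_X` of holomorphic vector fields on `X`,
given by its sections on the open sets. -/
structure VFieldSubmodule where
  /-- The sections over an open set. -/
  sec : TopologicalSpace.Opens X → Set (VField E X)
  hol : ∀ {U v}, v ∈ sec U → ∀ x ∈ U, HolVFieldAt v x
  zero_mem : ∀ U, (fun _ => 0) ∈ sec U
  add_mem : ∀ {U v w}, v ∈ sec U → w ∈ sec U → (fun x => v x + w x) ∈ sec U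
  smul_mem : ∀ {U} {f : X → ℂ} {v}, (∀ x ∈ U, HolFunAt 𝓘(ℂ, E) f x) → v ∈ sec U →
    (fun x => f x • v x) ∈ sec U
  restrict : ∀ {U V v}, V ≤ U → v ∈ sec U → v ∈ sec V
  glue : ∀ {U v}, (∀ x ∈ U, ∃ V ≤ U, x ∈ V ∧ ∃ w ∈ sec V, ∀ y ∈ V, v y = w y) → v ∈ sec U

/-- The sections `v_1, …, v_r` of `I` over `U` generate the `𝒪_U`-module `I|_U`. -/
def VFieldSubmodule.GeneratedBy (I : VFieldSubmodule E X) (U : TopologicalSpace.Opens X) {r : ℕ}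
    (v : Fin r → VField E X) : Prop :=
  (∀ i, v i ∈ I.sec U) ∧
    ∀ V ≤ U, ∀ w ∈ I.sec V, ∀ x ∈ V, ∃ W ≤ V, x ∈ W ∧ ∃ f : Fin r → X → ℂ,
      (∀ i, ∀ y ∈ W, HolFunAt 𝓘(ℂ, E) (f i) y) ∧ ∀ y ∈ W, w y = ∑ i, f i y • v i y

/-- A singular foliation: a coherent `𝒪_X`-submodule of `Θ_X` that is a Lie subalgebra. A submodule
of the locally free module `Θ_X` is coherent if and only if it is locally finitely generated. -/
structure VFieldSubmodule.IsFoliation (I : VFieldSubmodule E X) : Prop where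
  coherent : ∀ x : X, ∃ U : TopologicalSpace.Opens X, x ∈ U ∧
    ∃ (m : ℕ) (w : Fin m → VField E X), I.GeneratedBy U w
  lie : ∀ U, ∀ v ∈ I.sec U, ∀ w ∈ I.sec U, VectorField.mlieBracket 𝓘(ℂ, E) v w ∈ I.sec U

/-- The sections `v_1, …, v_r` of `I` over `U` generate `I|_U` and satisfy `[v_i, v_j] = 0`. -/
structure VFieldSubmodule.CommutingGenerators (I : VFieldSubmodule E X)
    (U : TopologicalSpace.Opens X) {r : ℕ} (v : Fin r → VField E X) : Prop where
  gen : I.GeneratedBy U v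
  comm : ∀ i j, ∀ x ∈ U, VectorField.mlieBracket 𝓘(ℂ, E) (v i) (v j) x = 0

theorem VFieldSubmodule.CommutingGenerators.hol {I : VFieldSubmodule E X}
    {U : TopologicalSpace.Opens X} {r : ℕ} {v : Fin r → VField E X}
    (h : I.CommutingGenerators U v) : ∀ i, ∀ x ∈ U, HolVFieldAt (v i) x :=
  fun i => I.hol (h.gen.1 i)

/-- Locally, `I` has commuting generators whose symbols form a regular sequence in `𝒪_{T^*X}`. -/
def VFieldSubmodule.LocallySymbolRegular (I : VFieldSubmodule E X) : Prop :=
  ∀ x : X, ∃ U : TopologicalSpace.Opens X, x ∈ U ∧ ∃ (r : ℕ) (v : Fin r → VField E X)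
    (h : I.CommutingGenerators U v), SymbolsRegular U v h.hol

/-- Locally, `I` has commuting generators that form a regular sequence in `𝒟_X`. -/
def VFieldSubmodule.LocallyOperatorRegular (I : VFieldSubmodule E X) : Prop :=
  ∀ x : X, ∃ U : TopologicalSpace.Opens X, x ∈ U ∧ ∃ (r : ℕ) (v : Fin r → VField E X)
    (h : I.CommutingGenerators U v), OperatorsRegular U v h.hol

end VectorFields

end HolFoliation

end

/-! Filter `𝒟_{X,x}` by order. On principal symbols, right multiplication by a vector field becomes
multiplication by its symbol, so regularity can be lifted from symbols to operators. Let `P v_d =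
∑_{j<d} Q_j v_j`. First, the `Q_j` can be replaced by coefficients of order at most that of `P`
(`exists_strict`). If the order of the coefficients is too high, their top parts satisfy a relation
between symbols; regularity makes the top symbol of the last coefficient a combination of the
earlier symbols, and commutativity moves that part into the other coefficients. Comparing principal
symbols then shows that the symbol of `P` is a combination of the `σ(v_j)`. Subtract the
corresponding operator and induct on the order of `P` (`exists_of_mul_eq`).

Two inputs make this concrete. In a chart every operator is the quantization of a polynomial in `ξ`
over `𝒪_{X,x}`. Its principal symbol is well defined because the commutator with the coordinate
`z_i` differentiates the full symbol in `ξ_i` (`eq_zero_of_quantize_mem`). The vanishing brackets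
become commutation of operators through `lieDeriv_mlieBracket`.

The second input bridges a gap: the hypothesis is about germs of holomorphic functions on `T^*X`,
whereas principal symbols are polynomials in `ξ`. Work at the zero covector over `x` and expand
along the fibres. Since each `σ(v_j)` is linear in `ξ`, the degree `k` part of `p = ∑ c_j σ(v_j)`,
with `p` homogeneous of degree `k`, only involves the degree `k - 1` parts of the `c_j`; this yields
polynomial coefficients (`gradedRegular`). -/

noncomputable section

namespace HolFoliation

/-! ### Regular sequences in filtered rings -/

section Filtered

variable {D : Type*} [Ring D]

/-- An exhaustive increasing filtration of `D` by additive subgroups `F k` (thought of as the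
elements of order `< k`), together with a sequence `v` of commuting elements of order `≤ 1` the
symbols of whose first `r` members form a regular sequence. -/
structure SymbolRegularFiltration (F : ℕ → AddSubgroup D) (v : ℕ → D) (r : ℕ) : Prop where
  zero : F 0 = ⊥
  mono : Monotone F
  exhaustive : ∀ P, ∃ k, P ∈ F k
  mul_mem : ∀ k P j, P ∈ F k → P * v j ∈ F (k + 1)
  comm : ∀ i j, v i * v j = v j * v i
  regular : ∀ d < r, ∀ k, ∀ P ∈ F (k + 1), ∀ Q : ℕ → D, (∀ j, Q j ∈ F (k + 1)) →
    P * v d - ∑ j ∈ Finset.range d, Q j * v j ∈ F (k + 1) →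
    ∃ C : ℕ → D, (∀ j, C j ∈ F k) ∧ P - ∑ j ∈ Finset.range d, C j * v j ∈ F k

namespace SymbolRegularFiltration

variable {F : ℕ → AddSubgroup D} {v : ℕ → D} {r : ℕ}

theorem exists_common (h : SymbolRegularFiltration F v r) (Q : ℕ → D) (d : ℕ) :
    ∃ k, ∀ j < d, Q j ∈ F k := by
  choose k hk using fun j => h.exhaustive (Q j)
  exact ⟨(Finset.range d).sup k, fun j hj =>
    h.mono (Finset.le_sup (f := k) (Finset.mem_range.2 hj)) (hk j)⟩

/-- Multiplying a combination of `v 0, …, v (d - 1)` by `v d` gives such a combination. -/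
theorem sum_mul_comm (h : SymbolRegularFiltration F v r) (C : ℕ → D) (d : ℕ) :
    (∑ j ∈ Finset.range d, C j * v j) * v d = ∑ j ∈ Finset.range d, C j * v d * v j := by
  rw [Finset.sum_mul]
  exact Finset.sum_congr rfl fun j _ => by rw [mul_assoc, h.comm, ← mul_assoc]

/-- An element of order `≤ m` of the left ideal generated by `v 0, …, v (d - 1)` is a combination
of these with coefficients of order `≤ m - 1`. -/
theorem exists_strict (h : SymbolRegularFiltration F v r) {d : ℕ} (hd : d ≤ r) {m : ℕ}
    {Q : ℕ → D} (hQ : ∑ j ∈ Finset.range d, Q j * v j ∈ F (m + 1)) :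
    ∃ Q' : ℕ → D, (∀ j, Q' j ∈ F m) ∧
      ∑ j ∈ Finset.range d, Q j * v j = ∑ j ∈ Finset.range d, Q' j * v j := by
  induction d generalizing m Q with
  | zero => exact ⟨0, fun _ => zero_mem _, by simp⟩
  | succ d ih =>
    have key : ∀ k (Q : ℕ → D), (∀ j < d + 1, Q j ∈ F (m + k)) →
        ∑ j ∈ Finset.range (d + 1), Q j * v j ∈ F (m + 1) →
        ∃ Q' : ℕ → D, (∀ j, Q' j ∈ F m) ∧
          ∑ j ∈ Finset.range (d + 1), Q j * v j = ∑ j ∈ Finset.range (d + 1), Q' j * v j := by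
      -- Here `k` measures the excess order of the coefficients. Each pass of this inner induction
      -- lowers it by one; the outer induction on `d` handles the coefficients other than the last.
      intro k
      induction k with
      | zero =>
        refine fun Q hQ _ => ⟨fun j => if j < d + 1 then Q j else 0, fun j => ?_, ?_⟩
        · dsimp only
          split_ifs with hj
          · exact hQ j hj
          · exact zero_mem _
        · exact Finset.sum_congr rfl fun j hj => by simp only [if_pos (Finset.mem_range.1 hj)]
      | succ k ihk =>
        intro Q hQF hQ
        -- The combination has order at most `m`, so the terms of order `m + k + 1` cancel. The
        -- coefficients at indices `≥ d` are set to `0` because `regular` bounds the order of every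
        -- `Q j`.
        have hsum : Q d * v d -
            ∑ j ∈ Finset.range d, (if j < d then - Q j else 0) * v j ∈ F (m + k + 1) := by
          have : ∑ j ∈ Finset.range d, (if j < d then - Q j else 0) * v j =
              - ∑ j ∈ Finset.range d, Q j * v j := by
            rw [← Finset.sum_neg_distrib]
            exact Finset.sum_congr rfl fun j hj => by
              rw [if_pos (Finset.mem_range.1 hj), neg_mul]
          rw [this, sub_neg_eq_add, add_comm (Q d * v d), ← Finset.sum_range_succ (fun j => Q j * v j)]
          exact h.mono (by omega) hQ
        obtain ⟨C, hC, hR⟩ := h.regular d hd (m + k) (Q d) (hQF d (Nat.lt_succ_self d)) _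
          (fun j => by
            split_ifs with hj
            · exact neg_mem (hQF j (by omega))
            · exact zero_mem _) hsum
        set R := Q d - ∑ j ∈ Finset.range d, C j * v j with hRdef
        -- Only the remainder `R`, of lower order, is kept as the last coefficient; the rest of `Q
        -- d` passes through `v d` by commutativity.
        have hsplit : ∑ j ∈ Finset.range (d + 1), Q j * v j =
            ∑ j ∈ Finset.range d, (Q j + C j * v d) * v j + R * v d := by
          simp only [add_mul, Finset.sum_add_distrib]
          rw [Finset.sum_range_succ, ← h.sum_mul_comm, hRdef, sub_mul]
          abel
        have hlow : ∑ j ∈ Finset.range d, (Q j + C j * v d) * v j ∈ F (m + k + 1) := by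
          rw [← add_sub_cancel_right (∑ j ∈ Finset.range d, (Q j + C j * v d) * v j) (R * v d),
            ← hsplit]
          exact sub_mem (h.mono (by omega) hQ) (h.mul_mem _ _ d hR)
        obtain ⟨Q', hQ', hsum'⟩ := ih (by omega) hlow
        have hsplit' : ∑ j ∈ Finset.range (d + 1), Q j * v j =
            ∑ j ∈ Finset.range (d + 1), Function.update Q' d R j * v j := by
          rw [hsplit, hsum', Finset.sum_range_succ, Function.update_self]
          congr 1
          exact Finset.sum_congr rfl fun j hj => by
            rw [Function.update_of_ne (Finset.mem_range.1 hj).ne]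
        rw [hsplit'] at hQ ⊢
        refine ihk _ (fun j _ => ?_) hQ
        rcases eq_or_ne j d with rfl | hj
        · rwa [Function.update_self]
        · rw [Function.update_of_ne hj]
          exact hQ' j
    obtain ⟨k, hk⟩ := h.exists_common Q (d + 1)
    exact key k Q (fun j hj => h.mono (by omega) (hk j hj)) hQ

/-- If the symbols of the `v j` form a regular sequence, then so do the `v j`. -/
theorem exists_of_mul_eq (h : SymbolRegularFiltration F v r) {d : ℕ} (hd : d < r) {P : D}
    {Q : ℕ → D} (hP : P * v d = ∑ j ∈ Finset.range d, Q j * v j) :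
    ∃ C : ℕ → D, P = ∑ j ∈ Finset.range d, C j * v j := by
  obtain ⟨k, hk⟩ := h.exhaustive P
  induction k generalizing P Q with
  | zero =>
    rw [h.zero, AddSubgroup.mem_bot] at hk
    exact ⟨0, by simp [hk]⟩
  | succ k ih =>
    -- Without this bound on the coefficients, the relation would say nothing about the principal
    -- symbol of `P`.
    obtain ⟨Q', hQ', hsum⟩ := h.exists_strict hd.le (hP ▸ h.mul_mem _ _ d hk)
    obtain ⟨C, hC, hR⟩ := h.regular d hd k P hk Q' hQ' (by
      rw [hP, hsum, sub_self]
      exact zero_mem _)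
    -- The remainder has lower order and satisfies a relation of the same kind, since `C j * v j * v
    -- d = C j * v d * v j`.
    obtain ⟨C', hC'⟩ := ih (P := P - ∑ j ∈ Finset.range d, C j * v j)
      (Q := fun j => Q j - C j * v d) (by
        rw [sub_mul, h.sum_mul_comm, hP, ← Finset.sum_sub_distrib]
        simp only [sub_mul]) hR
    refine ⟨fun j => C' j + C j, ?_⟩
    simp only [add_mul, Finset.sum_add_distrib, ← hC', sub_add_cancel]

end SymbolRegularFiltration

end Filtered

/-! ### Polynomials of bounded degree -/

section LowDegree

open MvPolynomial

variable {ι A : Type*} [CommRing A]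

variable (ι A) in
/-- The polynomials of total degree `< k`. -/
def lowDegree (k : ℕ) : Submodule A (MvPolynomial ι A) where
  carrier := {p | ∀ m : ι →₀ ℕ, k ≤ m.degree → coeff m p = 0}
  zero_mem' := fun _ _ => coeff_zero _
  add_mem' := fun hp hq m hm => by rw [coeff_add, hp m hm, hq m hm, add_zero]
  smul_mem' := fun a p hp m hm => by rw [coeff_smul, hp m hm, smul_zero]

theorem mem_lowDegree {k : ℕ} {p : MvPolynomial ι A} :
    p ∈ lowDegree ι A k ↔ ∀ m : ι →₀ ℕ, k ≤ m.degree → coeff m p = 0 :=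
  Iff.rfl

theorem lowDegree_zero : lowDegree ι A 0 = ⊥ :=
  (Submodule.eq_bot_iff _).2 fun p hp => by
    ext m
    exact hp m (Nat.zero_le _)

theorem lowDegree_mono : Monotone (lowDegree ι A) :=
  fun _ _ h _ hp m hm => hp m (h.trans hm)

theorem exists_mem_lowDegree (p : MvPolynomial ι A) : ∃ k, p ∈ lowDegree ι A k := by
  refine ⟨p.support.sup Finsupp.degree + 1, fun m hm => ?_⟩
  by_contra h
  have := Finset.le_sup (f := Finsupp.degree) (mem_support_iff.2 h)
  omega

theorem monomial_mem_lowDegree {m : ι →₀ ℕ} {k : ℕ} (h : m.degree < k) (a : A) :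
    monomial m a ∈ lowDegree ι A k := by
  classical
  intro m' hm'
  rw [coeff_monomial, if_neg]
  rintro rfl
  omega

theorem mul_X_mem_lowDegree {k : ℕ} {p : MvPolynomial ι A} (hp : p ∈ lowDegree ι A k) (i : ι) :
    p * X i ∈ lowDegree ι A (k + 1) := by
  classical
  intro m hm
  rw [coeff_mul_X']
  split_ifs with h
  · refine hp _ ?_
    have h1 : m - Finsupp.single i 1 + Finsupp.single i 1 = m :=
      tsub_add_cancel_of_le (Finsupp.single_le_iff.2
        (Nat.one_le_iff_ne_zero.2 (Finsupp.mem_support_iff.1 h)))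
    have h2 := congrArg Finsupp.degree h1
    rw [map_add, Finsupp.degree_single] at h2
    omega
  · rfl

theorem mul_X_mem_lowDegree_of_pred {k : ℕ} {p : MvPolynomial ι A}
    (hp : p ∈ lowDegree ι A (k - 1)) (i : ι) : p * X i ∈ lowDegree ι A k := by
  cases k with
  | zero =>
    rw [Nat.zero_sub, lowDegree_zero, Submodule.mem_bot] at hp
    rw [hp, zero_mul]
    exact zero_mem _
  | succ k => exact mul_X_mem_lowDegree hp i

theorem pderiv_mem_lowDegree {k : ℕ} {p : MvPolynomial ι A} (hp : p ∈ lowDegree ι A k) (i : ι) :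
    pderiv i p ∈ lowDegree ι A (k - 1) := by
  intro m hm
  rw [coeff_pderiv, hp, zero_mul]
  rw [map_add, Finsupp.degree_single]
  omega

/-- Supports induction on the order of an operator: every nonconstant monomial loses one variable,
which corresponds to a rightmost derivation. -/
theorem lowDegree_succ_le_span (k : ℕ) : lowDegree ι A (k + 1) ≤
    Submodule.span A ({1} ∪ {p | ∃ q ∈ lowDegree ι A k, ∃ i, p = q * X i}) := by
  intro p hp
  rw [p.as_sum]
  refine Submodule.sum_mem _ fun m hm => ?_
  have hmk : m.degree < k + 1 := by
    by_contra h
    exact mem_support_iff.1 hm (hp m (by omega))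
  rcases eq_or_ne m 0 with rfl | h0
  · rw [← mul_one (coeff 0 p), ← smul_eq_mul, ← smul_monomial]
    exact Submodule.smul_mem _ _ (Submodule.subset_span (Or.inl rfl))
  · obtain ⟨i, hi⟩ := Finsupp.ne_iff.1 h0
    have h1 : m - Finsupp.single i 1 + Finsupp.single i 1 = m :=
      tsub_add_cancel_of_le (Finsupp.single_le_iff.2 (Nat.one_le_iff_ne_zero.2 hi))
    have h2 := congrArg Finsupp.degree h1
    rw [map_add, Finsupp.degree_single] at h2
    refine Submodule.subset_span (Or.inr ⟨monomial (m - Finsupp.single i 1) (coeff m p),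
      monomial_mem_lowDegree (by omega) _, i, ?_⟩)
    rw [← pow_one (X i), ← monomial_add_single, h1]

theorem sub_homogeneousComponent_mem_lowDegree {k : ℕ} {p : MvPolynomial ι A}
    (hp : p ∈ lowDegree ι A (k + 1)) : p - homogeneousComponent k p ∈ lowDegree ι A k := by
  intro m hm
  rw [coeff_sub, coeff_homogeneousComponent]
  split_ifs with h
  · exact sub_self _
  · rw [hp m (by omega), sub_zero]

theorem IsHomogeneous.mem_lowDegree {k : ℕ} {p : MvPolynomial ι A} (hp : p.IsHomogeneous k) :
    p ∈ lowDegree ι A (k + 1) := fun m hm => hp.coeff_eq_zero (by omega)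

variable [Fintype ι]

/-- The linear form with given coefficients. -/
def linearForm (a : ι → A) : MvPolynomial ι A := ∑ i, C (a i) * X i

theorem isHomogeneous_linearForm (a : ι → A) : (linearForm a).IsHomogeneous 1 :=
  IsHomogeneous.sum _ _ _ fun i _ => by
    simpa using (isHomogeneous_C ι (a i)).mul (isHomogeneous_X A i)

theorem mul_linearForm (p : MvPolynomial ι A) (a : ι → A) :
    p * linearForm a = ∑ i, (a i • p) * X i := by
  rw [linearForm, Finset.mul_sum]
  exact Finset.sum_congr rfl fun i _ => by rw [smul_eq_C_mul]; ring

/-- Euler's identity gives `(k + 1) p = ∑ X_i ∂_i p`, and `k + 1` is invertible. -/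
theorem eq_zero_of_pderiv_eq_zero (K : Type*) [Field K] [CharZero K] [Algebra K A] {k : ℕ} {p : MvPolynomial ι A}
    (hp : p.IsHomogeneous (k + 1)) (h : ∀ i, pderiv i p = 0) : p = 0 := by
  have h1 := hp.sum_X_mul_pderiv
  simp only [h, mul_zero, Finset.sum_const_zero] at h1
  have h2 : ((k + 1 : K)⁻¹ * (k + 1 : K)) • p = 0 := by
    rw [mul_smul, ← Nat.cast_succ, Nat.cast_smul_eq_nsmul, ← h1, smul_zero]
  rwa [inv_mul_cancel₀ (Nat.cast_add_one_ne_zero k), one_smul] at h2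

end LowDegree

/-! ### Operators with polynomial symbols -/

section Quantization

open MvPolynomial

/-- The Leibniz rule as a commutation relation between operators. -/
theorem deriv_mul_mulLeft {K A : Type*} [CommRing K] [CommRing A] [Algebra K A]
    (D : Derivation K A A) (a : A) :
    (D : Module.End K A) * LinearMap.mulLeft K a =
      LinearMap.mulLeft K a * (D : Module.End K A) + LinearMap.mulLeft K (D a) := by
  ext f
  simp [mul_comm f]

variable {K A ι : Type*} [Field K] [CommRing A] [Algebra K A] [DecidableEq ι]

/-- `∂ i` are commuting derivations and `z i` elements with `∂ i (z j) = δ i j`. -/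
structure IsCoordinateSystem (D : ι → Derivation K A A) (z : ι → A) : Prop where
  comm : ∀ i j, Commute (D i : Module.End K A) (D j : Module.End K A)
  apply_coord : ∀ i j, D i (z j) = if i = j then 1 else 0

namespace IsCoordinateSystem

variable {D : ι → Derivation K A A} {z : ι → A}

theorem commute_pow (h : IsCoordinateSystem D z) (α β : ι →₀ ℕ) (i j : ι) :
    Commute ((D i : Module.End K A) ^ α i) ((D j : Module.End K A) ^ β j) :=
  (h.comm i j).pow_pow _ _

theorem pairwise_commute_pow (h : IsCoordinateSystem D z) (s : Set ι) (α : ι →₀ ℕ) :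
    s.Pairwise (Function.onFun Commute fun i => (D i : Module.End K A) ^ α i) :=
  fun i _ j _ _ => h.commute_pow α α i j

variable [Fintype ι]

/-- The iterated derivative of a given multi-index. -/
def multiDeriv (h : IsCoordinateSystem D z) (α : ι →₀ ℕ) : Module.End K A :=
  Finset.univ.noncommProd (fun i => (D i : Module.End K A) ^ α i)
    (h.pairwise_commute_pow _ α)

theorem multiDeriv_zero (h : IsCoordinateSystem D z) : h.multiDeriv 0 = 1 := by
  rw [multiDeriv, Finset.noncommProd_eq_pow_card _ _ _ 1 (by simp), one_pow]

theorem multiDeriv_add_single (h : IsCoordinateSystem D z) (α : ι →₀ ℕ) (i : ι) :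
    h.multiDeriv (α + Finsupp.single i 1) = h.multiDeriv α * (D i : Module.End K A) := by
  have e : (D i : Module.End K A) = h.multiDeriv (Finsupp.single i 1) := by
    have hi : i ∉ Finset.univ.erase i := Finset.notMem_erase i _
    simp only [multiDeriv]
    rw [Finset.noncommProd_congr (Finset.insert_erase (Finset.mem_univ i)).symm
        (g := fun j => (D j : Module.End K A) ^ Finsupp.single i 1 j) (fun _ _ => rfl)
        (h.pairwise_commute_pow _ _),
      Finset.noncommProd_insert_of_notMem _ _ _ (h.pairwise_commute_pow _ _) hi,
      Finset.noncommProd_eq_pow_card _ _ _ 1, one_pow, Finsupp.single_eq_same, pow_one, mul_one]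
    intro j hj
    rw [Finsupp.single_eq_of_ne (Finset.ne_of_mem_erase hj), pow_zero]
  rw [e]
  have := Finset.noncommProd_mul_distrib (s := Finset.univ)
    (fun j => (D j : Module.End K A) ^ α j)
    (fun j => (D j : Module.End K A) ^ Finsupp.single i 1 j)
    (h.pairwise_commute_pow _ _) (h.pairwise_commute_pow _ _)
    (fun j _ k _ _ => h.commute_pow _ _ _ _)
  simp only [multiDeriv]
  rw [← this]
  refine Finset.noncommProd_congr rfl (fun j _ => ?_) _
  rw [Finsupp.add_apply, pow_add]
  rfl

/-- The operator `∑ a_α ∂^α` with full symbol the polynomial `∑ a_α ξ^α`. -/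
def quantize (h : IsCoordinateSystem D z) : MvPolynomial ι A →ₗ[A] Module.End K A :=
  (basisMonomials ι A).constr A h.multiDeriv

theorem quantize_monomial (h : IsCoordinateSystem D z) (α : ι →₀ ℕ) (a : A) :
    h.quantize (monomial α a) = a • h.multiDeriv α := by
  have : h.quantize (monomial α 1) = h.multiDeriv α := by
    have e : (monomial α 1 : MvPolynomial ι A) = basisMonomials ι A α := by simp
    rw [quantize, e]
    exact (basisMonomials ι A).constr_basis A h.multiDeriv α
  rw [← this, ← map_smul, smul_monomial, smul_eq_mul, mul_one]

theorem quantize_one (h : IsCoordinateSystem D z) : h.quantize 1 = 1 := by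
  rw [← C_1, ← monomial_zero', quantize_monomial, multiDeriv_zero, one_smul]

theorem quantize_C (h : IsCoordinateSystem D z) (a : A) :
    h.quantize (C a) = LinearMap.mulLeft K a := by
  rw [← monomial_zero', quantize_monomial, multiDeriv_zero]
  rfl

theorem quantize_mul_X (h : IsCoordinateSystem D z) (p : MvPolynomial ι A) (i : ι) :
    h.quantize (p * X i) = h.quantize p * (D i : Module.End K A) := by
  induction p using MvPolynomial.induction_on' with
  | monomial m a =>
    rw [← pow_one (X i), ← monomial_add_single, quantize_monomial, quantize_monomial,
      multiDeriv_add_single]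
    rfl
  | add p q hp hq => rw [add_mul, map_add, map_add, hp, hq, add_mul]

/-- The commutator with a coordinate acts on full symbols as a derivative in `ξ`. This formula is
exact, with no lower-order error, so it allows a symbol to be recovered from its operator. -/
theorem quantize_mul_coord (h : IsCoordinateSystem D z) (p : MvPolynomial ι A) (i : ι) :
    h.quantize p * LinearMap.mulLeft K (z i) =
      LinearMap.mulLeft K (z i) * h.quantize p + h.quantize (pderiv i p) := by
  induction p using MvPolynomial.induction_on with
  | C a =>
    rw [quantize_C, pderiv_C, map_zero, add_zero]
    ext f
    simp [mul_left_comm]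
  | add p q hp hq => simp only [map_add, add_mul, mul_add, hp, hq]; abel
  | mul_X p j hp =>
    rw [quantize_mul_X, mul_assoc, deriv_mul_mulLeft, mul_add, ← mul_assoc, hp, h.apply_coord,
      add_mul, ← quantize_mul_X, mul_assoc, ← quantize_mul_X, Derivation.leibniz, pderiv_X,
      map_add, add_assoc]
    congr 1
    rw [add_comm, smul_eq_mul, smul_eq_mul, mul_comm (X j)]
    congr 1
    rcases eq_or_ne i j with rfl | hij
    · rw [if_pos rfl, Pi.single_eq_same, mul_one, LinearMap.mulLeft_one]
      exact mul_one _
    · simp [hij.symm]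

/-- Moving `a` to the left past a derivation costs only the term with `D i a`, which has one
derivation fewer. The truncated `k - 1` is harmless: for `k = 0` both polynomials vanish. -/
theorem exists_quantize_mul_mulLeft (h : IsCoordinateSystem D z) {k : ℕ} {p : MvPolynomial ι A}
    (hp : p ∈ lowDegree ι A k) (a : A) : ∃ q ∈ lowDegree ι A (k - 1),
      h.quantize p * LinearMap.mulLeft K a = h.quantize (a • p + q) := by
  induction k generalizing p a with
  | zero =>
    rw [lowDegree_zero, Submodule.mem_bot] at hp
    exact ⟨0, zero_mem _, by simp [hp]⟩
  | succ k ih =>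
    have hspan := lowDegree_succ_le_span k hp
    clear hp
    induction hspan using Submodule.span_induction generalizing a with
    | mem p hp =>
      rcases hp with rfl | ⟨p, hp, i, rfl⟩
      · exact ⟨0, zero_mem _, by rw [add_zero, smul_eq_C_mul, mul_one, quantize_C, quantize_one,
          one_mul]⟩
      · obtain ⟨q, hq, hqe⟩ := ih hp a
        obtain ⟨q', hq', hqe'⟩ := ih hp (D i a)
        refine ⟨q * X i + (D i a • p + q'), add_mem (mul_X_mem_lowDegree_of_pred hq i)
          (add_mem (Submodule.smul_mem _ _ hp) (lowDegree_mono (Nat.sub_le k 1) hq')), ?_⟩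
        rw [quantize_mul_X, mul_assoc, deriv_mul_mulLeft, mul_add, ← mul_assoc, hqe, hqe',
          ← quantize_mul_X, ← map_add, add_mul, smul_mul_assoc, add_assoc]
    | zero => exact ⟨0, zero_mem _, by simp⟩
    | add p p' _ _ hp hp' =>
      obtain ⟨q, hq, hqe⟩ := hp a
      obtain ⟨q', hq', hqe'⟩ := hp' a
      exact ⟨q + q', add_mem hq hq', by
        rw [map_add, add_mul, hqe, hqe', ← map_add, smul_add]; congr 1; abel⟩
    | smul b p _ hp =>
      obtain ⟨q, hq, hqe⟩ := hp a
      exact ⟨b • q, Submodule.smul_mem _ _ hq, by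
        rw [map_smul, smul_mul_assoc, hqe, ← map_smul, smul_add, smul_comm]⟩

end IsCoordinateSystem

end Quantization

/-! ### Operators with commuting symbols -/

section OperatorFiltration

open MvPolynomial

variable {K A ι : Type*} [Field K] [CommRing A] [Algebra K A] [DecidableEq ι] [Fintype ι]

/-- The operator `∑ a i ∂ i`. -/
def fieldOperator (D : ι → Derivation K A A) (a : ι → A) : Module.End K A :=
  ∑ i, a i • (D i : Module.End K A)

namespace IsCoordinateSystem

variable {D : ι → Derivation K A A} {z : ι → A}

/-- Multiplicativity of principal symbols: the error `q` sits one degree below the leading part of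
`p * linearForm a`. -/
theorem exists_quantize_mul_fieldOperator (h : IsCoordinateSystem D z) {k : ℕ}
    {p : MvPolynomial ι A} (hp : p ∈ lowDegree ι A k) (a : ι → A) : ∃ q ∈ lowDegree ι A k,
      h.quantize p * fieldOperator D a = h.quantize (p * linearForm a + q) := by
  choose q hq hqe using fun i => h.exists_quantize_mul_mulLeft hp (a i)
  refine ⟨∑ i, q i * X i, sum_mem fun i _ => mul_X_mem_lowDegree_of_pred (hq i) i, ?_⟩
  rw [mul_linearForm, ← Finset.sum_add_distrib, fieldOperator, Finset.mul_sum, map_sum]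
  refine Finset.sum_congr rfl fun i _ => ?_
  rw [← add_mul, quantize_mul_X, ← hqe, mul_assoc]
  rfl

theorem quantize_mul_fieldOperator_mem (h : IsCoordinateSystem D z) {k : ℕ}
    {p : MvPolynomial ι A} (hp : p ∈ lowDegree ι A k) (a : ι → A) :
    ∃ q ∈ lowDegree ι A (k + 1), h.quantize p * fieldOperator D a = h.quantize q := by
  choose q hq hqe using fun i => h.exists_quantize_mul_mulLeft hp (a i)
  refine ⟨∑ i, (a i • p + q i) * X i, sum_mem fun i _ => mul_X_mem_lowDegree
    (add_mem (Submodule.smul_mem _ _ hp) (lowDegree_mono (Nat.sub_le k 1) (hq i))) i, ?_⟩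
  rw [fieldOperator, Finset.mul_sum, map_sum]
  refine Finset.sum_congr rfl fun i _ => ?_
  rw [quantize_mul_X, ← hqe, mul_assoc]
  rfl

/-- A nonzero homogeneous polynomial is the principal symbol of its quantization. -/
theorem eq_zero_of_quantize_mem [CharZero K] (h : IsCoordinateSystem D z) {k : ℕ}
    {p q : MvPolynomial ι A} (hp : p.IsHomogeneous k) (hq : q ∈ lowDegree ι A k)
    (hpq : h.quantize p = h.quantize q) : p = 0 := by
  induction k generalizing p q with
  | zero =>
    rw [lowDegree_zero, Submodule.mem_bot] at hq
    have hC : p = C (coeff 0 p) := totalDegree_eq_zero_iff_eq_C.1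
      (Nat.le_zero.1 hp.totalDegree_le)
    rw [hq, map_zero, hC, quantize_C] at hpq
    have := LinearMap.congr_fun hpq 1
    rw [LinearMap.mulLeft_apply, mul_one, LinearMap.zero_apply] at this
    rw [hC, this, C_0]
  | succ k ih =>
    refine eq_zero_of_pderiv_eq_zero K hp fun i => ?_
    -- Taking commutators with the coordinate on both sides gives the same problem one degree lower.
    refine ih (by simpa using hp.pderiv (i := i)) (pderiv_mem_lowDegree hq i) ?_
    have h1 := h.quantize_mul_coord p i
    rw [hpq, h.quantize_mul_coord q i] at h1
    exact (add_left_cancel h1).symm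

theorem quantize_mem_adjoin (h : IsCoordinateSystem D z) {S : Set (Module.End K A)}
    (hS : ∀ i, (D i : Module.End K A) ∈ S) (p : MvPolynomial ι A) :
    h.quantize p ∈ Algebra.adjoin K (Set.range (fun a : A => LinearMap.mulLeft K a) ∪ S) := by
  induction p using MvPolynomial.induction_on with
  | C a => exact h.quantize_C a ▸ Algebra.subset_adjoin (Or.inl ⟨a, rfl⟩)
  | add p q hp hq => exact map_add h.quantize p q ▸ add_mem hp hq
  | mul_X p i hp =>
    exact h.quantize_mul_X p i ▸ mul_mem hp (Algebra.subset_adjoin (Or.inr (hS i)))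

/-- The quantizations are stable under right multiplication by each generator, hence by the whole
algebra; apply this to the identity operator. -/
theorem exists_quantize_of_mem_adjoin (h : IsCoordinateSystem D z) {S : Set (Module.End K A)}
    (hS : ∀ T ∈ S, ∃ a, T = fieldOperator D a) {T : Module.End K A}
    (hT : T ∈ Algebra.adjoin K (Set.range (fun a : A => LinearMap.mulLeft K a) ∪ S)) :
    ∃ p, h.quantize p = T := by
  have key : ∀ p, ∃ q, h.quantize q = h.quantize p * T := by
    induction hT using Algebra.adjoin_induction with
    | mem T hT =>
      intro p
      obtain ⟨k, hk⟩ := exists_mem_lowDegree p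
      rcases hT with ⟨a, rfl⟩ | hT
      · obtain ⟨q, _, hq⟩ := h.exists_quantize_mul_mulLeft hk a
        exact ⟨_, hq.symm⟩
      · obtain ⟨a, rfl⟩ := hS T hT
        obtain ⟨q, _, hq⟩ := h.quantize_mul_fieldOperator_mem hk a
        exact ⟨_, hq.symm⟩
    | algebraMap c =>
      intro p
      refine ⟨algebraMap K A c • p, ?_⟩
      rw [map_smul, algebraMap_smul, ← Algebra.commutes, ← Algebra.smul_def]
    | add T U _ _ hT hU =>
      intro p
      obtain ⟨q, hq⟩ := hT p
      obtain ⟨q', hq'⟩ := hU p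
      exact ⟨q + q', by rw [map_add, hq, hq', mul_add]⟩
    | mul T U _ _ hT hU =>
      intro p
      obtain ⟨q, hq⟩ := hT p
      obtain ⟨q', hq'⟩ := hU q
      exact ⟨q', by rw [hq', hq, mul_assoc]⟩
  obtain ⟨p, hp⟩ := key 1
  exact ⟨p, by rw [hp, quantize_one, one_mul]⟩

/-- The operators of order `< k` in a subalgebra. -/
def orderFiltration (h : IsCoordinateSystem D z) (𝒟 : Subalgebra K (Module.End K A)) (k : ℕ) :
    AddSubgroup 𝒟 :=
  ((lowDegree ι A k).toAddSubgroup.map h.quantize.toAddMonoidHom).comap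
    (𝒟.val : 𝒟 →+ Module.End K A)

theorem mem_orderFiltration (h : IsCoordinateSystem D z) {𝒟 : Subalgebra K (Module.End K A)}
    {k : ℕ} {P : 𝒟} : P ∈ h.orderFiltration 𝒟 k ↔
      ∃ p ∈ lowDegree ι A k, h.quantize p = (P : Module.End K A) :=
  Iff.rfl

/-- The linear forms with coefficients `a 0, …, a (r - 1)` form a regular sequence, tested on
homogeneous polynomials. -/
def GradedRegular (a : ℕ → ι → A) (r : ℕ) : Prop :=
  ∀ d < r, ∀ (k : ℕ) (p : MvPolynomial ι A) (q : ℕ → MvPolynomial ι A), p.IsHomogeneous k →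
    p * linearForm (a d) = ∑ j ∈ Finset.range d, q j * linearForm (a j) →
    ∃ c : ℕ → MvPolynomial ι A, (∀ j, c j ∈ lowDegree ι A k) ∧
      p = ∑ j ∈ Finset.range d, c j * linearForm (a j)

/-- Top homogeneous components translate relations modulo lower order into polynomial relations, to
which `GradedRegular` applies; its coefficients are then quantized. -/
theorem symbolRegularFiltration [CharZero K] (h : IsCoordinateSystem D z)
    {𝒟 : Subalgebra K (Module.End K A)} (h1 : ∀ p, h.quantize p ∈ 𝒟)
    (h2 : ∀ T ∈ 𝒟, ∃ p, h.quantize p = T) {v : ℕ → 𝒟} {a : ℕ → ι → A} {r : ℕ}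
    (hv : ∀ j, (v j : Module.End K A) = fieldOperator D (a j))
    (hcomm : ∀ i j, v i * v j = v j * v i) (ha : GradedRegular a r) :
    SymbolRegularFiltration (h.orderFiltration 𝒟) v r where
  zero := by
    refine (AddSubgroup.eq_bot_iff_forall _).2 fun P hP => ?_
    obtain ⟨p, hp, hpP⟩ := h.mem_orderFiltration.1 hP
    rw [lowDegree_zero, Submodule.mem_bot] at hp
    rw [hp, map_zero] at hpP
    exact Subtype.ext hpP.symm
  mono := fun k l hkl P hP => by
    obtain ⟨p, hp, hpP⟩ := h.mem_orderFiltration.1 hP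
    exact h.mem_orderFiltration.2 ⟨p, lowDegree_mono hkl hp, hpP⟩
  exhaustive := fun P => by
    obtain ⟨p, hp⟩ := h2 P P.2
    obtain ⟨k, hk⟩ := exists_mem_lowDegree p
    exact ⟨k, h.mem_orderFiltration.2 ⟨p, hk, hp⟩⟩
  mul_mem := fun k P j hP => by
    obtain ⟨p, hp, hpP⟩ := h.mem_orderFiltration.1 hP
    obtain ⟨q, hq, hqe⟩ := h.quantize_mul_fieldOperator_mem hp (a j)
    exact h.mem_orderFiltration.2 ⟨q, hq, by rw [← hqe, hpP, ← hv]; rfl⟩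
  comm := hcomm
  regular := fun d hd k P hP Q hQ hPQ => by
    obtain ⟨p, hp, hpP⟩ := h.mem_orderFiltration.1 hP
    choose q hq hqQ using fun j => h.mem_orderFiltration.1 (hQ j)
    obtain ⟨s, hs, hsPQ⟩ := h.mem_orderFiltration.1 hPQ
    obtain ⟨p', hp', hpe⟩ := h.exists_quantize_mul_fieldOperator hp (a d)
    choose q' hq' hqe using fun j => h.exists_quantize_mul_fieldOperator (hq j) (a j)
    have hp₀ := sub_homogeneousComponent_mem_lowDegree hp
    have hq₀ := fun j => sub_homogeneousComponent_mem_lowDegree (hq j)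
    set p₀ := homogeneousComponent k p with hp₀def
    set q₀ := fun j => homogeneousComponent k (q j) with hq₀def
    have hp₀h : p₀.IsHomogeneous k := homogeneousComponent_isHomogeneous k p
    have hq₀h : ∀ j, (q₀ j).IsHomogeneous k := fun j => homogeneousComponent_isHomogeneous k (q j)
    have hmem : ∀ (u : MvPolynomial ι A) (b : ι → A), u ∈ lowDegree ι A k →
        u * linearForm b ∈ lowDegree ι A (k + 1) := fun u b hu => by
      rw [mul_linearForm]
      exact sum_mem fun i _ => mul_X_mem_lowDegree (Submodule.smul_mem _ _ hu) i
    have hzero : p₀ * linearForm (a d) - ∑ j ∈ Finset.range d, q₀ j * linearForm (a j) = 0 := by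
      -- The left side is homogeneous of degree `k + 1`. The witness collects everything of smaller
      -- degree: the full symbol `s` of the given combination, the lower parts of `p` and `q j`, and
      -- the errors `p'` and `q' j` from multiplication.
      refine h.eq_zero_of_quantize_mem (k := k + 1)
        (q := s - ((p - p₀) * linearForm (a d) + p') +
          ∑ j ∈ Finset.range d, ((q j - q₀ j) * linearForm (a j) + q' j))
        ((hp₀h.mul (isHomogeneous_linearForm _)).sub
          (IsHomogeneous.sum _ _ _ fun j _ => (hq₀h j).mul (isHomogeneous_linearForm _)))
        (add_mem (sub_mem hs (add_mem (hmem _ _ hp₀) hp'))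
          (sum_mem fun j _ => add_mem (hmem _ _ (hq₀ j)) (hq' j))) ?_
      have e : h.quantize s = h.quantize (p * linearForm (a d) + p') -
          ∑ j ∈ Finset.range d, h.quantize (q j * linearForm (a j) + q' j) := by
        rw [hsPQ, ← hpe, hpP]
        simp only [← hqe, hqQ, ← hv]
        push_cast
        rfl
      rw [map_add, map_sub h.quantize s, e, ← map_sum, ← map_sub, ← map_sub, ← map_add]
      congr 1
      simp only [sub_mul, Finset.sum_add_distrib, Finset.sum_sub_distrib]
      ring
    obtain ⟨c, hc, hcp⟩ := ha d hd k p₀ q₀ hp₀h (sub_eq_zero.1 hzero)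
    refine ⟨fun j => ⟨h.quantize (c j), h1 _⟩, fun j => h.mem_orderFiltration.2 ⟨c j, hc j, rfl⟩,
      h.mem_orderFiltration.2 ?_⟩
    choose c' hc' hce using fun j => h.exists_quantize_mul_fieldOperator (hc j) (a j)
    -- The chosen combination cancels `p₀` exactly and leaves the multiplication errors `c' j`.
    refine ⟨p - p₀ - ∑ j ∈ Finset.range d, c' j, sub_mem hp₀ (sum_mem fun j _ => hc' j), ?_⟩
    have e : ((∑ j ∈ Finset.range d, (⟨h.quantize (c j), h1 _⟩ : 𝒟) * v j : 𝒟) :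
        Module.End K A) = h.quantize (p₀ + ∑ j ∈ Finset.range d, c' j) := by
      rw [hcp, ← Finset.sum_add_distrib, map_sum]
      push_cast
      exact Finset.sum_congr rfl fun j _ => by rw [hv, hce]
    push_cast at e ⊢
    rw [e, ← hpP, ← map_sub, sub_sub]

end IsCoordinateSystem

end OperatorFiltration

/-! ### Taylor expansion along the fibres -/

section Taylor

open MvPolynomial

variable {A S ι : Type*} [CommRing A] [CommRing S]

/-- A retraction `ε : S → A` of a ring homomorphism `ρ : A → S` together with elements `ξ i` and
derivations `δ i` over `A` that behave like coordinates on the fibres and the derivatives in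
their directions. -/
structure IsFibreSystem [DecidableEq ι] (ρ : A →+* S) (ε : S →+* A) (ξ : ι → S) (δ : ι → S →+ S) : Prop where
  retract : ∀ a, ε (ρ a) = a
  zero_section : ∀ i, ε (ξ i) = 0
  leibniz : ∀ i b c, δ i (b * c) = b * δ i c + c * δ i b
  deriv_base : ∀ i a, δ i (ρ a) = 0
  deriv_coord : ∀ i j, δ i (ξ j) = if i = j then 1 else 0

/-- Lets the Taylor recursion be computed on polynomial functions by formal derivatives. -/
theorem IsFibreSystem.deriv_eval [DecidableEq ι] {ρ : A →+* S} {ε : S →+* A} {ξ : ι → S}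
    {δ : ι → S →+ S} (h : IsFibreSystem ρ ε ξ δ) (p : MvPolynomial ι A) (i : ι) :
    δ i (eval₂ ρ ξ p) = eval₂ ρ ξ (pderiv i p) := by
  induction p using MvPolynomial.induction_on with
  | C a => simp [h.deriv_base]
  | add p q hp hq => simp only [eval₂_add, map_add, hp, hq]
  | mul_X p j hp =>
    rw [eval₂_mul, eval₂_X, h.leibniz, hp, h.deriv_coord, Derivation.leibniz, pderiv_X,
      eval₂_add, smul_eq_mul, smul_eq_mul, eval₂_mul, eval₂_mul, eval₂_X]
    rcases eq_or_ne i j with rfl | hij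
    · simp
    · simp [hij, hij.symm]

variable [Fintype ι] (K : Type*) [Field K] [Algebra K A]

/-- The homogeneous parts of the Taylor expansion along the fibres. -/
def taylor (ε : S →+* A) (δ : ι → S →+ S) : ℕ → S → MvPolynomial ι A
  | 0, b => C (ε b)
  | k + 1, b => ((k : K) + 1)⁻¹ • ∑ i, X i * taylor ε δ k (δ i b)

theorem isHomogeneous_taylor (ε : S →+* A) (δ : ι → S →+ S) (k : ℕ) (b : S) :
    (taylor K ε δ k b).IsHomogeneous k := by
  induction k generalizing b with
  | zero => exact isHomogeneous_C _ _
  | succ k ih =>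
    rw [taylor, ← algebraMap_smul A, smul_eq_C_mul]
    have := (isHomogeneous_C ι (algebraMap K A ((k : K) + 1)⁻¹)).mul (IsHomogeneous.sum Finset.univ
      (fun i => X i * taylor K ε δ k (δ i b)) (1 + k) fun i _ => (isHomogeneous_X A i).mul (ih _))
    rwa [zero_add, add_comm 1 k] at this

theorem taylor_add (ε : S →+* A) (δ : ι → S →+ S) (k : ℕ) (b c : S) :
    taylor K ε δ k (b + c) = taylor K ε δ k b + taylor K ε δ k c := by
  induction k generalizing b c with
  | zero => simp [taylor]
  | succ k ih => simp only [taylor, map_add, ih, mul_add, Finset.sum_add_distrib, smul_add]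

theorem taylor_sum (ε : S →+* A) (δ : ι → S →+ S) (k : ℕ) {κ : Type*} (s : Finset κ) (b : κ → S) :
    taylor K ε δ k (∑ j ∈ s, b j) = ∑ j ∈ s, taylor K ε δ k (b j) :=
  map_sum (AddMonoidHom.mk' (taylor K ε δ k) (taylor_add K ε δ k)) b s

namespace IsFibreSystem

variable [DecidableEq ι] {ρ : A →+* S} {ε : S →+* A} {ξ : ι → S} {δ : ι → S →+ S}

theorem taylor_base_mul (h : IsFibreSystem ρ ε ξ δ) (k : ℕ) (a : A) (b : S) :
    taylor K ε δ k (ρ a * b) = C a * taylor K ε δ k b := by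
  induction k generalizing b with
  | zero => simp [taylor, h.retract]
  | succ k ih =>
    simp only [taylor, h.leibniz, h.deriv_base, mul_zero, add_zero, ih]
    rw [mul_smul_comm, Finset.mul_sum]
    simp only [mul_left_comm]

/-- The recursion defining `taylor` is Euler's identity solved for the polynomial, so it
reconstructs `p` from its derivatives. -/
theorem taylor_eval [CharZero K] (h : IsFibreSystem ρ ε ξ δ) {k : ℕ} {p : MvPolynomial ι A}
    (hp : p.IsHomogeneous k) : taylor K ε δ k (eval₂ ρ ξ p) = p := by
  induction k generalizing p with
  | zero =>
    have hC : p = C (coeff 0 p) := totalDegree_eq_zero_iff_eq_C.1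
      (Nat.le_zero.1 hp.totalDegree_le)
    rw [hC, eval₂_C, taylor, h.retract]
  | succ k ih =>
    have e : ∀ i, taylor K ε δ k (eval₂ ρ ξ (pderiv i p)) = pderiv i p := fun i =>
      ih (by simpa using hp.pderiv (i := i))
    simp only [taylor, h.deriv_eval, e]
    rw [hp.sum_X_mul_pderiv, ← Nat.cast_smul_eq_nsmul K, smul_smul, Nat.cast_succ,
      inv_mul_cancel₀ (Nat.cast_add_one_ne_zero k), one_smul]

theorem taylor_zero_mul_linearForm (h : IsFibreSystem ρ ε ξ δ) (b : S) (a : ι → A) :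
    taylor K ε δ 0 (b * eval₂ ρ ξ (linearForm a)) = 0 := by
  simp [taylor, linearForm, eval₂_sum, h.zero_section]

/-- A linear form shifts fibre degree by exactly one. In the inductive step the Leibniz rule
contributes `k + 1` copies of the product from differentiating `b` and one from differentiating the
form, matching the factor `k + 2` in the recursion. -/
theorem taylor_succ_mul_linearForm [CharZero K] (h : IsFibreSystem ρ ε ξ δ) (k : ℕ) (b : S) (a : ι → A) :
    taylor K ε δ (k + 1) (b * eval₂ ρ ξ (linearForm a)) =
      taylor K ε δ k b * linearForm a := by
  have hd : ∀ i, δ i (eval₂ ρ ξ (linearForm a)) = ρ (a i) := fun i => by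
    have : pderiv i (linearForm a) = C (a i) := by
      simp [linearForm, Pi.single_apply]
    rw [h.deriv_eval, this, eval₂_C]
  have hsum : ∀ b k, ∑ i, X i * taylor K ε δ k (b * ρ (a i)) =
      taylor K ε δ k b * linearForm a := fun b k => by
    rw [linearForm, Finset.mul_sum]
    refine Finset.sum_congr rfl fun i _ => ?_
    rw [mul_comm b, h.taylor_base_mul K]
    ring
  induction k generalizing b with
  | zero =>
    simp only [taylor.eq_2, h.leibniz, hd, taylor_add, mul_add, Finset.sum_add_distrib, hsum]
    simp [mul_comm (eval₂ ρ ξ (linearForm a)), h.taylor_zero_mul_linearForm K]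
  | succ k ih =>
    rw [taylor]
    simp only [h.leibniz, hd, taylor_add, mul_add, Finset.sum_add_distrib, hsum,
      mul_comm (eval₂ ρ ξ (linearForm a)), ih]
    have : ∑ i, X i * (taylor K ε δ k (δ i b) * linearForm a) =
        ((k : K) + 1) • (taylor K ε δ (k + 1) b * linearForm a) := by
      rw [taylor, smul_mul_assoc, smul_smul, mul_inv_cancel₀ (Nat.cast_add_one_ne_zero k),
        one_smul, Finset.sum_mul]
      simp only [mul_assoc]
    have hk := Nat.cast_add_one_ne_zero (R := K) (k + 1)
    rw [this, inv_smul_eq_iff₀ hk, Nat.cast_succ, add_comm]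
    simp only [add_smul, one_smul]

/-- If the linear forms become a regular sequence in a ring `R` of functions on the total space
in which fibrewise Taylor expansion makes sense, then they are a regular sequence. -/
theorem gradedRegular [CharZero K] (h : IsFibreSystem ρ ε ξ δ) {R : Type*} [CommRing R]
    (Φ : MvPolynomial ι A →+* R) (Ψ : R →+* S) (hC : ∀ a, Ψ (Φ (C a)) = ρ a)
    (hX : ∀ i, Ψ (Φ (X i)) = ξ i) {a : ℕ → ι → A} {r : ℕ}
    (hreg : ∀ d < r, ∀ b : R, ∀ c : ℕ → R,
      b * Φ (linearForm (a d)) = ∑ j ∈ Finset.range d, c j * Φ (linearForm (a j)) →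
      ∃ c' : ℕ → R, b = ∑ j ∈ Finset.range d, c' j * Φ (linearForm (a j))) :
    IsCoordinateSystem.GradedRegular a r := by
  have hΨ : ∀ p, Ψ (Φ p) = eval₂ ρ ξ p := fun p => by
    have : Ψ.comp Φ = eval₂Hom ρ ξ := MvPolynomial.ringHom_ext (by simpa using hC) (by simpa using hX)
    exact RingHom.congr_fun this p
  intro d hd k p q hp hpq
  obtain ⟨c, hc⟩ := hreg d hd (Φ p) (fun j => Φ (q j)) (by
    simp only [← map_mul, hpq, map_sum])
  -- Taking degree `k` parts keeps `p` and truncates the analytic coefficients. In degree `0` the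
  -- right side vanishes, because linear forms are zero on the zero section.
  have hT : p = ∑ j ∈ Finset.range d,
      taylor K ε δ k (Ψ (c j) * eval₂ ρ ξ (linearForm (a j))) := by
    rw [← taylor_sum, ← h.taylor_eval K hp, ← hΨ, hc]
    simp only [map_sum, map_mul, hΨ]
  cases k with
  | zero =>
    refine ⟨0, fun _ => zero_mem _, ?_⟩
    rw [hT]
    simp [h.taylor_zero_mul_linearForm K]
  | succ k =>
    refine ⟨fun j => taylor K ε δ k (Ψ (c j)),
      fun j => IsHomogeneous.mem_lowDegree (isHomogeneous_taylor K ε δ k _), ?_⟩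
    rw [hT]
    simp only [h.taylor_succ_mul_linearForm K]

end IsFibreSystem

end Taylor

/-! ### Stalks -/

section Stalks

variable {E H M : Type*} [NormedAddCommGroup E] [NormedSpace ℂ E] [TopologicalSpace H]
  [TopologicalSpace M] [ChartedSpace H M] {I : ModelWithCorners ℂ E H}
  {E' H' N : Type*} [NormedAddCommGroup E'] [NormedSpace ℂ E'] [TopologicalSpace H']
  [TopologicalSpace N] [ChartedSpace H' N] {J : ModelWithCorners ℂ E' H'}

theorem exists_funGerm {x : M} (s : Stalk I x) :
    ∃ (f : M → ℂ) (hf : HolFunAt I f x), s = funGerm I f hf := by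
  obtain ⟨_, f, hf, rfl⟩ := s
  exact ⟨f, hf, rfl⟩

theorem HolFunAt.add {x : M} {f g : M → ℂ} (hf : HolFunAt I f x) (hg : HolFunAt I g x) :
    HolFunAt I (f + g) x :=
  ContMDiffAt.add hf hg

theorem HolFunAt.mul {x : M} {f g : M → ℂ} (hf : HolFunAt I f x) (hg : HolFunAt I g x) :
    HolFunAt I (f * g) x :=
  ContMDiffAt.mul hf hg

theorem funGerm_add {x : M} {f g : M → ℂ} (hf : HolFunAt I f x) (hg : HolFunAt I g x) :
    funGerm I f hf + funGerm I g hg = funGerm I (f + g) (hf.add hg) := rfl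

theorem holFunAt_sum {κ : Type*} (s : Finset κ) {x : M} {f : κ → M → ℂ}
    (hf : ∀ i, HolFunAt I (f i) x) : HolFunAt I (fun y => ∑ i ∈ s, f i y) x :=
  ContMDiffAt.sum fun i _ => hf i

theorem funGerm_sum {κ : Type*} (s : Finset κ) {x : M} {f : κ → M → ℂ}
    (hf : ∀ i, HolFunAt I (f i) x) :
    ∑ i ∈ s, funGerm I (f i) (hf i) = funGerm I (fun y => ∑ i ∈ s, f i y) (holFunAt_sum s hf) := by
  classical
  induction s using Finset.induction_on with
  | empty =>
    rw [Finset.sum_empty]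
    exact Subtype.ext (Germ.coe_eq.2 (.of_forall fun y => by simp))
  | insert i s hi ih =>
    rw [Finset.sum_insert hi, ih, funGerm_add]
    exact Subtype.ext (Germ.coe_eq.2 (.of_forall fun y => by simp [Finset.sum_insert hi]))

theorem HolFunAt.comp_holomorphic {f : N → ℂ} {q : M} {q' : N} (hf : HolFunAt J f q') {g : M → N}
    (hg : ContMDiffAt I J ω g q) (h : g q = q') : HolFunAt I (fun y => f (g y)) q := by
  subst h
  exact ContMDiffAt.comp q hf hg

theorem tendsto_of_contMDiffAt {q : M} {q' : N} {g : M → N} (hg : ContMDiffAt I J ω g q)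
    (h : g q = q') : Tendsto g (𝓝 q) (𝓝 q') :=
  h ▸ hg.continuousAt

/-- Pulling back germs of holomorphic functions along a holomorphic map. -/
def stalkMap {q : M} {q' : N} (g : M → N) (hg : ContMDiffAt I J ω g q) (h : g q = q') :
    Stalk J q' →+* Stalk I q where
  toFun s := ⟨s.1.compTendsto g (tendsto_of_contMDiffAt hg h), by
    obtain ⟨_, f, hf, rfl⟩ := s
    exact ⟨fun y => f (g y), hf.comp_holomorphic hg h, rfl⟩⟩
  map_one' := rfl
  map_zero' := rfl
  map_mul' := by
    rintro ⟨_, f, hf, rfl⟩ ⟨_, f', hf', rfl⟩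
    rfl
  map_add' := by
    rintro ⟨_, f, hf, rfl⟩ ⟨_, f', hf', rfl⟩
    rfl

end Stalks

/-! ### Vector fields as derivations -/

section Derivations

variable {E X : Type*} [NormedAddCommGroup E] [NormedSpace ℂ E] [TopologicalSpace X]
  [ChartedSpace E X] 

theorem HolFunAt.mdifferentiableAt {f : X → ℂ} {x : X} (hf : HolFunAt 𝓘(ℂ, E) f x) :
    MDifferentiableAt 𝓘(ℂ, E) 𝓘(ℂ, ℂ) f x :=
  ContMDiffAt.mdifferentiableAt hf (by simp)

theorem eventually_extChartAt_symm {x₀ : X} {z : E} (hz : z ∈ (extChartAt 𝓘(ℂ, E) x₀).target)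
    {p : X → Prop} (hp : ∀ᶠ y in 𝓝 ((extChartAt 𝓘(ℂ, E) x₀).symm z), p y) :
    ∀ᶠ w in 𝓝 z, w ∈ (extChartAt 𝓘(ℂ, E) x₀).target ∧
      p ((extChartAt 𝓘(ℂ, E) x₀).symm w) := by
  have h1 : ∀ᶠ w in 𝓝 z, w ∈ (extChartAt 𝓘(ℂ, E) x₀).target :=
    (isOpen_extChartAt_target x₀).mem_nhds hz
  exact h1.and ((continuousAt_extChartAt_symm'' hz).eventually hp)

variable [IsManifold 𝓘(ℂ, E) ω X]

theorem HolFunAt.eventually {f : X → ℂ} {x : X} (hf : HolFunAt 𝓘(ℂ, E) f x) :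
    ∀ᶠ y in 𝓝 x, HolFunAt 𝓘(ℂ, E) f y :=
  contMDiffAt_iff_contMDiffAt_nhds (by simp) |>.1 hf

theorem HolVFieldAt.eventually {v : VField E X} {x : X} (hv : HolVFieldAt v x) :
    ∀ᶠ y in 𝓝 x, HolVFieldAt v y :=
  contMDiffAt_iff_contMDiffAt_nhds (by simp) |>.1 hv

theorem lieDeriv_mul (v : VField E X) {f g : X → ℂ} {x : X} (hf : HolFunAt 𝓘(ℂ, E) f x)
    (hg : HolFunAt 𝓘(ℂ, E) g x) :
    lieDeriv v (f * g) =ᶠ[𝓝 x] f * lieDeriv v g + g * lieDeriv v f := by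
  filter_upwards [hf.eventually, hg.eventually] with y hy hy'
  have := (hy.mdifferentiableAt.hasMFDerivAt.mul hy'.mdifferentiableAt.hasMFDerivAt).mfderiv
  simp only [lieDeriv, Pi.add_apply, Pi.mul_apply]
  rw [this]
  rfl

theorem vfieldEnd_mul {x : X} {v : VField E X} (hv : HolVFieldAt v x)
    (s t : Stalk 𝓘(ℂ, E) x) :
    vfieldEnd v hv (s * t) = s * vfieldEnd v hv t + t * vfieldEnd v hv s := by
  obtain ⟨f, hf, rfl⟩ := exists_funGerm s
  obtain ⟨g, hg, rfl⟩ := exists_funGerm t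
  exact Subtype.ext (Germ.coe_eq.2 (lieDeriv_mul v hf hg))

/-- A germ of holomorphic vector field, as a derivation of the stalk. -/
def vfieldDerivation {x : X} (v : VField E X) (hv : HolVFieldAt v x) :
    Derivation ℂ (Stalk 𝓘(ℂ, E) x) (Stalk 𝓘(ℂ, E) x) :=
  Derivation.mk' (vfieldEnd v hv) (vfieldEnd_mul hv)

/-- The local representative of a vector field in the chart at `x₀`. -/
def chartField (x₀ : X) (v : VField E X) (z : E) : E :=
  VectorField.mpullbackWithin 𝓘(ℂ, E) 𝓘(ℂ, E) (extChartAt 𝓘(ℂ, E) x₀).symm v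
    (range 𝓘(ℂ, E)) z

theorem mdifferentiableAt_extChartAt_symm {x₀ : X} {z : E}
    (hz : z ∈ (extChartAt 𝓘(ℂ, E) x₀).target) :
    MDifferentiableAt 𝓘(ℂ, E) 𝓘(ℂ, E) (extChartAt 𝓘(ℂ, E) x₀).symm z :=
  ((contMDiffOn_extChartAt_symm (n := ω) x₀).contMDiffAt
    ((isOpen_extChartAt_target x₀).mem_nhds hz)).mdifferentiableAt (by simp)

/-- The chain rule: the derivative of the inverse chart carries `chartField x₀ v z` back to `v`. -/
theorem lieDeriv_extChartAt_symm (v : VField E X) {x₀ : X} {z : E}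
    (hz : z ∈ (extChartAt 𝓘(ℂ, E) x₀).target) {f : X → ℂ}
    (hf : HolFunAt 𝓘(ℂ, E) f ((extChartAt 𝓘(ℂ, E) x₀).symm z)) :
    lieDeriv v f ((extChartAt 𝓘(ℂ, E) x₀).symm z) =
      fderiv ℂ (fun w => f ((extChartAt 𝓘(ℂ, E) x₀).symm w)) z (chartField x₀ v z) := by
  have hinv := isInvertible_mfderivWithin_extChartAt_symm (I := 𝓘(ℂ, E)) hz
  have hcomp := mfderiv_comp z hf.mdifferentiableAt (mdifferentiableAt_extChartAt_symm hz)
  rw [mfderiv_eq_fderiv] at hcomp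
  have hc : chartField x₀ v z = (mfderivWithin 𝓘(ℂ, E) 𝓘(ℂ, E) (extChartAt 𝓘(ℂ, E) x₀).symm
      (range 𝓘(ℂ, E)) z).inverse (v ((extChartAt 𝓘(ℂ, E) x₀).symm z)) := rfl
  have hv : mfderiv 𝓘(ℂ, E) 𝓘(ℂ, E) (extChartAt 𝓘(ℂ, E) x₀).symm z
      (chartField x₀ v z : E) =
      v ((extChartAt 𝓘(ℂ, E) x₀).symm z) := by
    rw [hc]
    have e : mfderiv 𝓘(ℂ, E) 𝓘(ℂ, E) (extChartAt 𝓘(ℂ, E) x₀).symm z =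
      mfderivWithin 𝓘(ℂ, E) 𝓘(ℂ, E) (extChartAt 𝓘(ℂ, E) x₀).symm (range 𝓘(ℂ, E)) z := by
      rw [ModelWithCorners.range_eq_univ, mfderivWithin_univ]
    rw [e]
    exact hinv.self_apply_inverse _
  simp only [lieDeriv]
  rw [← hv]
  exact (congrArg (fun L : E →L[ℂ] ℂ => L (chartField x₀ v z)) hcomp).symm

theorem HolFunAt.comp_extChartAt_symm {x₀ : X} {z : E}
    (hz : z ∈ (extChartAt 𝓘(ℂ, E) x₀).target) {f : X → ℂ}
    (hf : HolFunAt 𝓘(ℂ, E) f ((extChartAt 𝓘(ℂ, E) x₀).symm z)) :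
    ContDiffAt ℂ ω (fun w => f ((extChartAt 𝓘(ℂ, E) x₀).symm w)) z :=
  contMDiffAt_iff_contDiffAt.1 (hf.comp_holomorphic ((contMDiffOn_extChartAt_symm (n := ω)
    x₀).contMDiffAt ((isOpen_extChartAt_target x₀).mem_nhds hz)) rfl)

/-- Separates the second-derivative term, symmetric in `v` and `w`, from the term that
differentiates `w`. -/
theorem lieDeriv_lieDeriv_extChartAt_symm [CompleteSpace E] {v w : VField E X} {x₀ : X} {z : E}
    (hz : z ∈ (extChartAt 𝓘(ℂ, E) x₀).target)
    (hw : HolVFieldAt w ((extChartAt 𝓘(ℂ, E) x₀).symm z))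
    (hwd : DifferentiableAt ℂ (chartField x₀ w) z) {f : X → ℂ}
    (hf : HolFunAt 𝓘(ℂ, E) f ((extChartAt 𝓘(ℂ, E) x₀).symm z)) :
    lieDeriv v (lieDeriv w f) ((extChartAt 𝓘(ℂ, E) x₀).symm z) =
      fderiv ℂ (fderiv ℂ (fun z => f ((extChartAt 𝓘(ℂ, E) x₀).symm z))) z
        (chartField x₀ v z) (chartField x₀ w z) +
      fderiv ℂ (fun z => f ((extChartAt 𝓘(ℂ, E) x₀).symm z)) z
        (fderiv ℂ (chartField x₀ w) z (chartField x₀ v z)) := by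
  set φ := extChartAt 𝓘(ℂ, E) x₀ with hφ
  have h1 := lieDeriv_extChartAt_symm v hz (f := lieDeriv w f) (holFunAt_lieDeriv hw hf)
  have h2 : (fun z => lieDeriv w f (φ.symm z)) =ᶠ[𝓝 z]
      fun z => fderiv ℂ (fun z => f (φ.symm z)) z (chartField x₀ w z) := by
    filter_upwards [eventually_extChartAt_symm hz hf.eventually] with z hz
    exact lieDeriv_extChartAt_symm w hz.1 hz.2
  have hg : ContDiffAt ℂ ω (fun z => f (φ.symm z)) z := HolFunAt.comp_extChartAt_symm hz hf
  have hg' : DifferentiableAt ℂ (fderiv ℂ (fun z => f (φ.symm z))) z :=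
    (hg.fderiv_right (m := 1) (by simp)).differentiableAt (by simp)
  rw [h1, h2.fderiv_eq, fderiv_clm_apply hg' hwd]
  simp [add_comm]

/-- The action of the bracket on functions is the commutator of the actions. -/
theorem lieDeriv_mlieBracket [CompleteSpace E] {v w : VField E X} {x : X}
    (hv : HolVFieldAt v x) (hw : HolVFieldAt w x) {f : X → ℂ} (hf : HolFunAt 𝓘(ℂ, E) f x) :
    lieDeriv (VectorField.mlieBracket 𝓘(ℂ, E) v w) f x =
      lieDeriv v (lieDeriv w f) x - lieDeriv w (lieDeriv v f) x := by
  have hdiff : ∀ {u : VField E X}, HolVFieldAt u x →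
      DifferentiableAt ℂ (chartField x u) (extChartAt 𝓘(ℂ, E) x x) := fun {u} hu => by
    have : IsManifold 𝓘(ℂ, E) 2 X := .of_le (n := ω) le_top
    have h : DifferentiableWithinAt ℂ (chartField x u)
        ((extChartAt 𝓘(ℂ, E) x).symm ⁻¹' univ ∩ range 𝓘(ℂ, E)) (extChartAt 𝓘(ℂ, E) x x) :=
      MDifferentiableWithinAt.differentiableWithinAt_mpullbackWithin_vectorField
        (ContMDiffAt.mdifferentiableAt hu (by simp)).mdifferentiableWithinAt
    rwa [ModelWithCorners.range_eq_univ, preimage_univ, univ_inter,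
      differentiableWithinAt_univ] at h
  set φ := extChartAt 𝓘(ℂ, E) x with hφ
  have hx : φ.symm (φ x) = x := extChartAt_to_inv x
  have h1 := lieDeriv_lieDeriv_extChartAt_symm (v := v) (mem_extChartAt_target x)
    (by rwa [extChartAt_to_inv]) (hdiff hw) (by rwa [extChartAt_to_inv])
  have h2 := lieDeriv_lieDeriv_extChartAt_symm (v := w) (mem_extChartAt_target x)
    (by rwa [extChartAt_to_inv]) (hdiff hv) (by rwa [extChartAt_to_inv])
  rw [← hφ, hx] at h1 h2
  rw [h1, h2]
  have hg : ContDiffAt ℂ ω (fun z => f (φ.symm z)) (φ x) :=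
    HolFunAt.comp_extChartAt_symm (mem_extChartAt_target x) (by rwa [extChartAt_to_inv])
  have hsymm : IsSymmSndFDerivAt ℂ (fun z => f (φ.symm z)) (φ x) :=
    hg.isSymmSndFDerivAt (by simp)
  -- The Hessian terms cancel by symmetry; what remains is the derivative of `f` along the bracket
  -- of the chart representatives.
  rw [hsymm.eq (chartField x v (φ x)) (chartField x w (φ x)), add_sub_add_left_eq_sub, ← map_sub]
  have hmd : MDifferentiableAt 𝓘(ℂ, E) 𝓘(ℂ, E) φ x :=
    mdifferentiableAt_extChartAt (ChartedSpace.mem_chart_source x)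
  have hgd : MDifferentiableAt 𝓘(ℂ, E) 𝓘(ℂ, ℂ) (fun z => f (φ.symm z)) (φ x) :=
    (hg.differentiableAt (by simp)).mdifferentiableAt
  have hfe : f =ᶠ[𝓝 x] (fun z => f (φ.symm z)) ∘ φ := by
    filter_upwards [extChartAt_source_mem_nhds (I := 𝓘(ℂ, E)) x] with y hy
    exact congrArg f (φ.left_inv hy).symm
  have hcomp := hfe.mfderiv_eq.trans (mfderiv_comp x hgd hmd)
  rw [mfderiv_eq_fderiv] at hcomp
  have hbr : VectorField.mlieBracket 𝓘(ℂ, E) v w x = (mfderiv 𝓘(ℂ, E) 𝓘(ℂ, E) φ x).inverse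
      (VectorField.lieBracketWithin ℂ (chartField x v) (chartField x w)
        (φ.symm ⁻¹' univ ∩ range 𝓘(ℂ, E)) (φ x) : E) := rfl
  rw [ModelWithCorners.range_eq_univ, preimage_univ, univ_inter,
    VectorField.lieBracketWithin_univ] at hbr
  have hinv : mfderiv 𝓘(ℂ, E) 𝓘(ℂ, E) φ x (VectorField.mlieBracket 𝓘(ℂ, E) v w x) =
      VectorField.lieBracket ℂ (chartField x v) (chartField x w) (φ x) := by
    rw [hbr]
    exact (isInvertible_mfderiv_extChartAt (mem_extChartAt_source x)).self_apply_inverse _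
  refine (congrArg (fun L : E →L[ℂ] ℂ => L (VectorField.mlieBracket 𝓘(ℂ, E) v w x))
    hcomp).trans ?_
  exact congrArg (fun y : E => fderiv ℂ (fun z => f (φ.symm z)) (φ x) y) hinv

end Derivations

/-! ### Local coordinates -/

section Coordinates

variable {E X : Type*} [NormedAddCommGroup E] [NormedSpace ℂ E] [TopologicalSpace X]
  [ChartedSpace E X] {ι : Type*} (b : Module.Basis ι ℂ E) (x : X)

/-- The coordinate functions of the chart at `x`. -/
def coordFun (i : ι) : X → ℂ := fun y => b.coord i (extChartAt 𝓘(ℂ, E) x y)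

section

variable [Fintype ι]

theorem continuous_coord (i : ι) : Continuous (b.coord i) := by
  have := b.finiteDimensional_of_finite
  exact (b.coord i).continuous_of_finiteDimensional

/-- The coordinates with respect to a basis, as continuous linear forms. -/
def coordCLM (i : ι) : E →L[ℂ] ℂ := ⟨b.coord i, continuous_coord b i⟩

theorem coordCLM_apply_basis [DecidableEq ι] (i j : ι) :
    coordCLM b i (b j) = if i = j then 1 else 0 := by
  simp [coordCLM, Finsupp.single_apply, eq_comm]

theorem holFunAt_coordFun (i : ι) : HolFunAt 𝓘(ℂ, E) (coordFun b x i) x :=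
  (coordCLM b i).contMDiff.contMDiffAt.comp x (contMDiffAt_extChartAt (n := ω))

theorem eventually_mem_extChartAt_source :
    ∀ᶠ y in 𝓝 x, y ∈ (extChartAt 𝓘(ℂ, E) x).source :=
  extChartAt_source_mem_nhds x

end

variable [IsManifold 𝓘(ℂ, E) ω X]

/-- The coordinate vector fields of the chart at `x`. -/
def coordField (i : ι) : VField E X :=
  fun y => (trivializationAt E (TangentSpace 𝓘(ℂ, E)) x).symmL ℂ y (b i)

theorem trivializationAt_coordField (i : ι) {y : X} (hy : y ∈ (chartAt E x).source) :
    (trivializationAt E (TangentSpace 𝓘(ℂ, E)) x ⟨y, coordField b x i y⟩).2 = b i := by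
  have h := (trivializationAt E (TangentSpace 𝓘(ℂ, E)) x).continuousLinearMapAt_symmL (R := ℂ)
    (b := y) hy (b i)
  rwa [Bundle.Trivialization.continuousLinearMapAt_apply,
    Bundle.Trivialization.coe_linearMapAt_of_mem _ hy] at h

theorem holVFieldAt_coordField (i : ι) : HolVFieldAt (coordField b x i) x := by
  refine (Bundle.contMDiffAt_section x).2 ?_
  refine (contMDiffAt_const (c := b i)).congr_of_eventuallyEq ?_
  filter_upwards [(chartAt E x).open_source.mem_nhds (ChartedSpace.mem_chart_source x)] with y hy
  exact trivializationAt_coordField b x i hy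

theorem chartField_coordField (i : ι) {z : E} (hz : z ∈ (extChartAt 𝓘(ℂ, E) x).target) :
    chartField x (coordField b x i) z = b i := by
  have hy : (extChartAt 𝓘(ℂ, E) x).symm z ∈ (chartAt E x).source := by
    rw [← extChartAt_source 𝓘(ℂ, E)]
    exact (extChartAt 𝓘(ℂ, E) x).map_target hz
  have h := TangentBundle.symmL_trivializationAt (I := 𝓘(ℂ, E)) hy
  have hz' : extChartAt 𝓘(ℂ, E) x ((extChartAt 𝓘(ℂ, E) x).symm z) = z :=
    (extChartAt 𝓘(ℂ, E) x).right_inv hz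
  have hinv := isInvertible_mfderivWithin_extChartAt_symm (I := 𝓘(ℂ, E)) hz
  have hc : coordField b x i ((extChartAt 𝓘(ℂ, E) x).symm z) =
      mfderivWithin 𝓘(ℂ, E) 𝓘(ℂ, E) (extChartAt 𝓘(ℂ, E) x).symm (range 𝓘(ℂ, E)) z (b i) := by
    have := congrArg (fun L : E →L[ℂ] E => L (b i)) h
    rw [hz'] at this
    exact this
  refine (congrArg (mfderivWithin 𝓘(ℂ, E) 𝓘(ℂ, E) (extChartAt 𝓘(ℂ, E) x).symm
    (range 𝓘(ℂ, E)) z).inverse hc).trans ?_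
  exact hinv.inverse_apply_self _

/-- In the chart the fields are constant, so both sides are values of the same symmetric second
derivative. -/
theorem lieDeriv_coordField_comm [CompleteSpace E] (i j : ι) {f : X → ℂ}
    (hf : HolFunAt 𝓘(ℂ, E) f x) :
    lieDeriv (coordField b x i) (lieDeriv (coordField b x j) f) =ᶠ[𝓝 x]
      lieDeriv (coordField b x j) (lieDeriv (coordField b x i) f) := by
  filter_upwards [eventually_mem_extChartAt_source (E := E) x, hf.eventually,
    (holVFieldAt_coordField b x i).eventually, (holVFieldAt_coordField b x j).eventually]
    with y hy hf hi hj
  have hz := (extChartAt 𝓘(ℂ, E) x).map_source hy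
  have hl := (extChartAt 𝓘(ℂ, E) x).left_inv hy
  set z := extChartAt 𝓘(ℂ, E) x y with hzdef
  rw [← hl] at hf hi hj ⊢
  have hconst : ∀ i, chartField x (coordField b x i) =ᶠ[𝓝 z] fun _ => b i := fun i => by
    filter_upwards [(isOpen_extChartAt_target x).mem_nhds hz] with w hw
    exact chartField_coordField b x i hw
  have hd : ∀ i, DifferentiableAt ℂ (chartField x (coordField b x i)) z := fun i =>
    (hconst i).differentiableAt_iff.2 (differentiableAt_const _)
  have hd' : ∀ i, fderiv ℂ (chartField x (coordField b x i)) z = 0 := fun i => by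
    rw [(hconst i).fderiv_eq, fderiv_fun_const]
    rfl
  rw [lieDeriv_lieDeriv_extChartAt_symm hz hj (hd j) hf,
    lieDeriv_lieDeriv_extChartAt_symm hz hi (hd i) hf, hd', hd']
  have hsymm : IsSymmSndFDerivAt ℂ (fun w => f ((extChartAt 𝓘(ℂ, E) x).symm w)) z :=
    (HolFunAt.comp_extChartAt_symm hz hf).isSymmSndFDerivAt (by simp)
  simp only [zero_apply, map_zero, add_zero]
  exact hsymm.eq _ _

variable [Fintype ι]

theorem lieDeriv_coordField_coordFun [DecidableEq ι] (i j : ι) :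
    lieDeriv (coordField b x i) (coordFun b x j) =ᶠ[𝓝 x] fun _ => if i = j then 1 else 0 := by
  filter_upwards [eventually_mem_extChartAt_source (E := E) x,
    (holFunAt_coordFun b x j).eventually] with y hy hf
  have hz := (extChartAt 𝓘(ℂ, E) x).map_source hy
  have hl := (extChartAt 𝓘(ℂ, E) x).left_inv hy
  have h := lieDeriv_extChartAt_symm (coordField b x i) hz (f := coordFun b x j) (by rwa [hl])
  rw [hl, chartField_coordField b x i hz] at h
  have he : (fun w => coordFun b x j ((extChartAt 𝓘(ℂ, E) x).symm w))
      =ᶠ[𝓝 (extChartAt 𝓘(ℂ, E) x y)] coordCLM b j := by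
    filter_upwards [(isOpen_extChartAt_target x).mem_nhds hz] with w hw
    exact congrArg (b.coord j) ((extChartAt 𝓘(ℂ, E) x).right_inv hw)
  rw [h, he.fderiv_eq, ContinuousLinearMap.fderiv, coordCLM_apply_basis]
  simp only [eq_comm]

/-- The components of a vector field in the chart at `x`. -/
def coeffFun (v : VField E X) (i : ι) : X → ℂ :=
  fun y => coordCLM b i (trivializationAt E (TangentSpace 𝓘(ℂ, E)) x ⟨y, v y⟩).2

variable {x}

theorem holFunAt_coeffFun {v : VField E X} (hv : HolVFieldAt v x) (i : ι) :
    HolFunAt 𝓘(ℂ, E) (coeffFun b x v i) x :=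
  (coordCLM b i).contMDiff.contMDiffAt.comp x ((Bundle.contMDiffAt_section x).1 hv)

theorem sum_coeffFun_smul (v : VField E X) {y : X} (hy : y ∈ (chartAt E x).source) :
    v y = ∑ i, coeffFun b x v i y • coordField b x i y := by
  set e := trivializationAt E (TangentSpace 𝓘(ℂ, E)) x with he
  have h := e.symmL_continuousLinearMapAt (R := ℂ) (b := y) hy (v y)
  rw [Bundle.Trivialization.continuousLinearMapAt_apply,
    Bundle.Trivialization.coe_linearMapAt_of_mem _ hy] at h
  have hs : (e ⟨y, v y⟩).2 = ∑ i, coeffFun b x v i y • b i := (b.sum_repr _).symm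
  rw [← h]
  dsimp only
  rw [hs, map_sum]
  simp only [map_smul]
  rfl

/-- The components of a germ of holomorphic vector field. -/
def coeffGerm {v : VField E X} (hv : HolVFieldAt v x) (i : ι) : Stalk 𝓘(ℂ, E) x :=
  funGerm 𝓘(ℂ, E) (coeffFun b x v i) (holFunAt_coeffFun b hv i)

variable (x)

/-- The coordinate vector fields as derivations. -/
def coordDerivation (i : ι) : Derivation ℂ (Stalk 𝓘(ℂ, E) x) (Stalk 𝓘(ℂ, E) x) :=
  vfieldDerivation (coordField b x i) (holVFieldAt_coordField b x i)

theorem isCoordinateSystem [CompleteSpace E] [DecidableEq ι] :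
    IsCoordinateSystem (coordDerivation b x)
      (fun i => funGerm 𝓘(ℂ, E) (coordFun b x i) (holFunAt_coordFun b x i)) where
  comm i j := by
    refine LinearMap.ext fun s => ?_
    obtain ⟨f, hf, rfl⟩ := exists_funGerm s
    exact Subtype.ext (Germ.coe_eq.2 (lieDeriv_coordField_comm b x i j hf))
  apply_coord i j := by
    have h := lieDeriv_coordField_coordFun b x i j
    split_ifs with hij
    · simp only [if_pos hij] at h
      exact Subtype.ext (Germ.coe_eq.2 h)
    · simp only [if_neg hij] at h
      exact Subtype.ext (Germ.coe_eq.2 h)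

variable {x}

theorem vfieldEnd_eq_fieldOperator {v : VField E X} (hv : HolVFieldAt v x) :
    vfieldEnd v hv = fieldOperator (coordDerivation b x) (coeffGerm b hv) := by
  refine LinearMap.ext fun s => ?_
  obtain ⟨f, hf, rfl⟩ := exists_funGerm s
  have h1 : fieldOperator (coordDerivation b x) (coeffGerm b hv) (funGerm 𝓘(ℂ, E) f hf) =
      ∑ i, funGerm 𝓘(ℂ, E) (coeffFun b x v i * lieDeriv (coordField b x i) f)
        ((holFunAt_coeffFun b hv i).mul
          (holFunAt_lieDeriv (holVFieldAt_coordField b x i) hf)) := by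
    rw [fieldOperator, LinearMap.sum_apply]
    rfl
  rw [h1, funGerm_sum]
  refine Subtype.ext (Germ.coe_eq.2 ?_)
  filter_upwards [(chartAt E x).open_source.mem_nhds (ChartedSpace.mem_chart_source x)] with y hy
  have := congrArg (fun u : E => (mfderiv 𝓘(ℂ, E) 𝓘(ℂ, ℂ) f y : E →L[ℂ] ℂ) u)
    (sum_coeffFun_smul b v hy)
  refine this.trans ?_
  refine (map_sum (mfderiv 𝓘(ℂ, E) 𝓘(ℂ, ℂ) f y : E →L[ℂ] ℂ) _ _).trans ?_
  exact Finset.sum_congr rfl fun i _ => map_smul (mfderiv 𝓘(ℂ, E) 𝓘(ℂ, ℂ) f y : E →L[ℂ] ℂ) _ _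

theorem vfieldEnd_commute [CompleteSpace E] {v w : VField E X} (hv : HolVFieldAt v x)
    (hw : HolVFieldAt w x)
    (h : ∀ᶠ y in 𝓝 x, VectorField.mlieBracket 𝓘(ℂ, E) v w y = 0) :
    vfieldEnd v hv * vfieldEnd w hw = vfieldEnd w hw * vfieldEnd v hv := by
  refine LinearMap.ext fun s => ?_
  obtain ⟨f, hf, rfl⟩ := exists_funGerm s
  refine Subtype.ext (Germ.coe_eq.2 ?_)
  filter_upwards [h, hv.eventually, hw.eventually, hf.eventually] with y hy hv hw hf
  have h1 := lieDeriv_mlieBracket hv hw hf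
  have h2 : lieDeriv (VectorField.mlieBracket 𝓘(ℂ, E) v w) f y = 0 := by
    simp only [lieDeriv]
    rw [hy]
    exact map_zero (mfderiv 𝓘(ℂ, E) 𝓘(ℂ, ℂ) f y : E →L[ℂ] ℂ)
  exact sub_eq_zero.1 (h1.symm.trans h2)

end Coordinates

/-! ### Functions on the cotangent bundle near the zero section -/

section CotangentBundle

variable {E X : Type*} [NormedAddCommGroup E] [NormedSpace ℂ E] [TopologicalSpace X]
  [ChartedSpace E X] {ι : Type*} (b : Module.Basis ι ℂ E) (x : X)

variable (E) in
/-- The point of the chart corresponding to the zero covector at `x`. -/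
def zeroPoint : E × (E →L[ℂ] ℂ) := (extChartAt 𝓘(ℂ, E) x x, 0)

theorem eventually_fst_mem_target :
    ∀ᶠ q in 𝓝 (zeroPoint E x), q.1 ∈ (extChartAt 𝓘(ℂ, E) x).target :=
  continuousAt_fst.eventually
    ((isOpen_extChartAt_target x).mem_nhds (mem_extChartAt_target (I := 𝓘(ℂ, E)) x))

theorem contMDiffAt_zeroSection :
    ContMDiffAt 𝓘(ℂ, E) 𝓘(ℂ, E × (E →L[ℂ] ℂ)) ω
      (fun y : X => (extChartAt 𝓘(ℂ, E) x y, (0 : E →L[ℂ] ℂ))) x :=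
  (contMDiffAt_extChartAt (n := ω)).prodMk_space contMDiffAt_const

variable [IsManifold 𝓘(ℂ, E) ω X]

/-- The zero covector at `x`. -/
def zeroCovector : Cotangent E X := ⟨x, 0⟩

/-- The parametrization of `T^*X` near the zero covector at `x` given by the chart at `x`. -/
def cotangentChartSymm : E × (E →L[ℂ] ℂ) → Cotangent E X :=
  (extChartAt (𝓘(ℂ, E).prod 𝓘(ℂ, E →L[ℂ] ℂ)) (zeroCovector x : Cotangent E X)).symm

theorem extChartAt_zeroCovector :
    extChartAt (𝓘(ℂ, E).prod 𝓘(ℂ, E →L[ℂ] ℂ)) (zeroCovector x : Cotangent E X)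
      (zeroCovector x) = (extChartAt 𝓘(ℂ, E) x x, 0) := by
  rw [FiberBundle.extChartAt]
  refine Prod.ext rfl ?_
  change ContinuousLinearMap.inCoordinates E (TangentSpace 𝓘(ℂ, E)) ℂ (Bundle.Trivial X ℂ) x x x x
    (0 : TangentSpace 𝓘(ℂ, E) x →L[ℂ] ℂ) = 0
  simp [ContinuousLinearMap.inCoordinates]

theorem mem_extChartAt_zeroCovector_target {q : E × (E →L[ℂ] ℂ)}
    (hq : q.1 ∈ (extChartAt 𝓘(ℂ, E) x).target) :
    q ∈ (extChartAt (𝓘(ℂ, E).prod 𝓘(ℂ, E →L[ℂ] ℂ)) (zeroCovector x : Cotangent E X)).target := by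
  rw [FiberBundle.extChartAt_target]
  refine ⟨⟨hq, ?_⟩, mem_univ _⟩
  have := (extChartAt 𝓘(ℂ, E) x).map_target hq
  rw [extChartAt_source] at this
  exact ⟨this, mem_univ _⟩

theorem cotangentChartSymm_base :
    cotangentChartSymm x (extChartAt 𝓘(ℂ, E) x x, 0) = (zeroCovector x : Cotangent E X) := by
  rw [cotangentChartSymm, ← extChartAt_zeroCovector, extChartAt_to_inv]

theorem contMDiffAt_cotangentChartSymm :
    ContMDiffAt 𝓘(ℂ, E × (E →L[ℂ] ℂ)) (𝓘(ℂ, E).prod 𝓘(ℂ, E →L[ℂ] ℂ)) ω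
      (cotangentChartSymm x : _ → Cotangent E X) (extChartAt 𝓘(ℂ, E) x x, 0) :=
  (contMDiffOn_extChartAt_symm (zeroCovector x : Cotangent E X)).contMDiffAt
    ((isOpen_extChartAt_target _).mem_nhds
      (mem_extChartAt_zeroCovector_target x (mem_extChartAt_target x)))

/-- The bundle chart is the trivialization followed by the base chart, so it leaves the fibre
coordinate unchanged. -/
theorem trivializationAt_cotangentChartSymm {q : E × (E →L[ℂ] ℂ)}
    (hq : q.1 ∈ (extChartAt 𝓘(ℂ, E) x).target) :
    trivializationAt (E →L[ℂ] ℂ)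
      (fun x : X => TangentSpace 𝓘(ℂ, E) x →L[ℂ] Bundle.Trivial X ℂ x) x
      (cotangentChartSymm x q) = ((extChartAt 𝓘(ℂ, E) x).symm q.1, q.2) := by
  have h1 : (extChartAt 𝓘(ℂ, E) x).symm q.1 ∈ (chartAt E x).source := by
    rw [← extChartAt_source 𝓘(ℂ, E)]
    exact (extChartAt 𝓘(ℂ, E) x).map_target hq
  have h2 : cotangentChartSymm x q = (trivializationAt (E →L[ℂ] ℂ)
      (fun x : X => TangentSpace 𝓘(ℂ, E) x →L[ℂ] Bundle.Trivial X ℂ x) x).toPartialEquiv.symm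
      ((extChartAt 𝓘(ℂ, E) x).symm q.1, q.2) := by
    rw [cotangentChartSymm, FiberBundle.extChartAt]
    rfl
  rw [h2]
  exact Bundle.Trivialization.apply_symm_apply' _ ⟨h1, mem_univ _⟩

theorem cotangentChartSymm_proj {q : E × (E →L[ℂ] ℂ)}
    (hq : q.1 ∈ (extChartAt 𝓘(ℂ, E) x).target) :
    (cotangentChartSymm x q : Cotangent E X).1 = (extChartAt 𝓘(ℂ, E) x).symm q.1 :=
  congrArg Prod.fst (trivializationAt_cotangentChartSymm x hq)

/-- Identifies the polynomial variable `X i`, realized as the symbol of a coordinate field, with a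
linear coordinate on the fibre. -/
theorem symbol_coordField_cotangentChartSymm (i : ι) {q : E × (E →L[ℂ] ℂ)}
    (hq : q.1 ∈ (extChartAt 𝓘(ℂ, E) x).target) :
    symbol (coordField b x i) (cotangentChartSymm x q) = q.2 (b i) := by
  have h := congrArg (fun p => p.2 (b i)) (trivializationAt_cotangentChartSymm (X := X) x hq)
  rw [hom_trivializationAt_apply] at h
  rw [← h]
  exact (congrArg (fun L : ℂ →L[ℂ] ℂ => L (symbol (coordField b x i) (cotangentChartSymm x q)))
    (Bundle.Trivial.continuousLinearMapAt_trivialization ℂ X ℂ (cotangentChartSymm x q).1)).symm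

theorem contMDiffAt_base :
    ContMDiffAt 𝓘(ℂ, E × (E →L[ℂ] ℂ)) 𝓘(ℂ, E) ω
      (fun q : E × (E →L[ℂ] ℂ) => (extChartAt 𝓘(ℂ, E) x).symm q.1) (zeroPoint E x) :=
  ContMDiffAt.comp (I' := 𝓘(ℂ, E)) (zeroPoint E x)
    ((contMDiffOn_extChartAt_symm x).contMDiffAt
      ((isOpen_extChartAt_target x).mem_nhds (mem_extChartAt_target x)))
    contDiffAt_fst.contMDiffAt

/-- Functions on `X` as functions on the chart of the cotangent bundle. -/
def baseMap : Stalk 𝓘(ℂ, E) x →+* Stalk 𝓘(ℂ, E × (E →L[ℂ] ℂ)) (zeroPoint E x) :=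
  stalkMap _ (contMDiffAt_base x) (extChartAt_to_inv x)

/-- Restriction of functions to the zero section. -/
def zeroSectionMap : Stalk 𝓘(ℂ, E × (E →L[ℂ] ℂ)) (zeroPoint E x) →+* Stalk 𝓘(ℂ, E) x :=
  stalkMap _ (contMDiffAt_zeroSection x) rfl

theorem holFunAt_fibreCoord (e : E) (q : E × (E →L[ℂ] ℂ)) :
    HolFunAt 𝓘(ℂ, E × (E →L[ℂ] ℂ)) (fun q : E × (E →L[ℂ] ℂ) => q.2 e) q :=
  ContDiffAt.contMDiffAt (contDiffAt_snd.clm_apply contDiffAt_const)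

/-- Makes `vfieldEnd` available on the model space, where it supplies the fibre derivatives on
germs. -/
theorem holVFieldAt_const {V : Type*} [NormedAddCommGroup V] [NormedSpace ℂ V] (c q : V) :
    HolVFieldAt (E := V) (X := V) (fun _ => c) q := by
  refine (Bundle.contMDiffAt_section q).2 ?_
  refine (contMDiffAt_const (c := c)).congr_of_eventuallyEq (.of_forall fun y => ?_)
  exact congrArg Prod.snd (trivializationAt_model_space_apply (I := 𝓘(ℂ, V))
    (⟨y, c⟩ : TangentBundle 𝓘(ℂ, V) V) q)

theorem lieDeriv_eq_fderiv {V : Type*} [NormedAddCommGroup V] [NormedSpace ℂ V] (c : V)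
    (f : V → ℂ) (q : V) : lieDeriv (E := V) (X := V) (fun _ => c) f q = fderiv ℂ f q c := by
  simp only [lieDeriv]
  rw [mfderiv_eq_fderiv]
  rfl

theorem holFunAt_symbol_coordField (i : ι) :
    HolFunAt (𝓘(ℂ, E).prod 𝓘(ℂ, E →L[ℂ] ℂ)) (symbol (coordField b x i))
      (zeroCovector x : Cotangent E X) :=
  holFunAt_symbol (zeroCovector x) (holVFieldAt_coordField b x i)

/-- Pulling back functions on `X` to the cotangent bundle. -/
def projMap : Stalk 𝓘(ℂ, E) x →+*
    Stalk (𝓘(ℂ, E).prod 𝓘(ℂ, E →L[ℂ] ℂ)) (zeroCovector x : Cotangent E X) :=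
  stalkMap (fun q : Cotangent E X => q.1) (Bundle.contMDiffAt_proj _) rfl

/-- Polynomials over the stalk as functions on the cotangent bundle. -/
def polynomialMap : MvPolynomial ι (Stalk 𝓘(ℂ, E) x) →+*
    Stalk (𝓘(ℂ, E).prod 𝓘(ℂ, E →L[ℂ] ℂ)) (zeroCovector x : Cotangent E X) :=
  MvPolynomial.eval₂Hom (projMap x) fun i => funGerm _ _ (holFunAt_symbol_coordField b x i)

/-- Functions on the cotangent bundle in the chart. -/
def chartMap : Stalk (𝓘(ℂ, E).prod 𝓘(ℂ, E →L[ℂ] ℂ)) (zeroCovector x : Cotangent E X) →+*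
    Stalk 𝓘(ℂ, E × (E →L[ℂ] ℂ)) (zeroPoint E x) :=
  stalkMap (cotangentChartSymm x) (contMDiffAt_cotangentChartSymm x) (cotangentChartSymm_base x)

theorem chartMap_projMap (s : Stalk 𝓘(ℂ, E) x) : chartMap x (projMap x s) = baseMap x s := by
  obtain ⟨f, hf, rfl⟩ := exists_funGerm s
  refine Subtype.ext (Germ.coe_eq.2 ?_)
  filter_upwards [eventually_fst_mem_target x] with q hq
  exact congrArg f (cotangentChartSymm_proj x hq)

theorem chartMap_symbol_coordField (i : ι) :
    chartMap x (funGerm _ _ (holFunAt_symbol_coordField b x i)) =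
      funGerm _ _ (holFunAt_fibreCoord (b i) (zeroPoint E x)) := by
  refine Subtype.ext (Germ.coe_eq.2 ?_)
  filter_upwards [eventually_fst_mem_target x] with q hq
  exact symbol_coordField_cotangentChartSymm b x i hq

variable [Fintype ι]

/-- The derivative in the direction of a coordinate of the fibre. -/
def fibreDeriv (i : ι) (q : E × (E →L[ℂ] ℂ)) : Stalk 𝓘(ℂ, E × (E →L[ℂ] ℂ)) q →+
    Stalk 𝓘(ℂ, E × (E →L[ℂ] ℂ)) q :=
  (vfieldEnd (E := E × (E →L[ℂ] ℂ)) (fun _ => ((0 : E), coordCLM b i))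
    (holVFieldAt_const _ q)).toAddMonoidHom

/-- The directions `coordCLM b i` form the basis of the fibre dual to `b`, so they are dual to the
fibre coordinates `q.2 (b j)`. -/
theorem isFibreSystem [DecidableEq ι] : IsFibreSystem (baseMap (X := X) x) (zeroSectionMap x)
    (fun i => funGerm _ _ (holFunAt_fibreCoord (b i) (zeroPoint E x)))
    (fun i => fibreDeriv b i (zeroPoint E x)) where
  retract s := by
    obtain ⟨f, hf, rfl⟩ := exists_funGerm s
    refine Subtype.ext (Germ.coe_eq.2 ?_)
    filter_upwards [eventually_mem_extChartAt_source (E := E) x] with y hy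
    exact congrArg f ((extChartAt 𝓘(ℂ, E) x).left_inv hy)
  zero_section i := rfl
  leibniz i s t := vfieldEnd_mul (E := E × (E →L[ℂ] ℂ)) (holVFieldAt_const _ _) s t
  deriv_base i s := by
    obtain ⟨f, hf, rfl⟩ := exists_funGerm s
    refine Subtype.ext (Germ.coe_eq.2 ?_)
    have hf' : HolFunAt 𝓘(ℂ, E) f ((extChartAt 𝓘(ℂ, E) x).symm (extChartAt 𝓘(ℂ, E) x x)) := by
      rwa [extChartAt_to_inv]
    have h := (continuousAt_fst (p := zeroPoint E x)).eventually
      (eventually_extChartAt_symm (mem_extChartAt_target x) hf'.eventually)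
    filter_upwards [h] with q hq
    rw [lieDeriv_eq_fderiv]
    have hg := (HolFunAt.comp_extChartAt_symm hq.1 hq.2).differentiableAt (by simp)
    have := hg.hasFDerivAt.comp q hasFDerivAt_fst
    rw [show (f ∘ fun q : E × (E →L[ℂ] ℂ) => (extChartAt 𝓘(ℂ, E) x).symm q.1) =
      (fun w => f ((extChartAt 𝓘(ℂ, E) x).symm w)) ∘ Prod.fst from rfl, this.fderiv]
    simp
  deriv_coord i j := by
    have h : lieDeriv (E := E × (E →L[ℂ] ℂ)) (fun _ => ((0 : E), coordCLM b i))
        (fun q : E × (E →L[ℂ] ℂ) => q.2 (b j)) = fun _ => if i = j then 1 else 0 := by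
      funext q
      rw [lieDeriv_eq_fderiv]
      have := (hasFDerivAt_snd (𝕜 := ℂ) (p := q)).clm_apply (hasFDerivAt_const (b j) q)
      rw [this.fderiv]
      simp [coordCLM_apply_basis]
    split_ifs with hij
    · simp only [if_pos hij] at h
      exact Subtype.ext (Germ.coe_eq.2 h.eventuallyEq)
    · simp only [if_neg hij] at h
      exact Subtype.ext (Germ.coe_eq.2 h.eventuallyEq)

variable {x}

/-- Matches the algebraic symbol, a linear form in the chart components of `v`, with the geometric
one on `T^*X`. -/
theorem polynomialMap_linearForm {v : VField E X} (hv : HolVFieldAt v x) :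
    polynomialMap b x (linearForm (coeffGerm b hv)) =
      funGerm _ (symbol v) (holFunAt_symbol (zeroCovector x) hv) := by
  have h : polynomialMap b x (linearForm (coeffGerm b hv)) =
      ∑ i, funGerm _ _ (((holFunAt_coeffFun b hv i).comp_holomorphic
        (Bundle.contMDiffAt_proj _) rfl).mul (holFunAt_symbol_coordField b x i)) := by
    simp only [polynomialMap, linearForm, map_sum, map_mul, MvPolynomial.coe_eval₂Hom,
      MvPolynomial.eval₂_C, MvPolynomial.eval₂_X]
    rfl
  rw [h, funGerm_sum]
  refine Subtype.ext (Germ.coe_eq.2 ?_)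
  have hproj : ContinuousAt (fun q : Cotangent E X => q.1) (zeroCovector x) :=
    (Bundle.contMDiffAt_proj (n := ω) (IB := 𝓘(ℂ, E)) (F := E →L[ℂ] ℂ)
      (fun x : X => TangentSpace 𝓘(ℂ, E) x →L[ℂ] Bundle.Trivial X ℂ x)).continuousAt
  filter_upwards [hproj.eventually ((chartAt E x).open_source.mem_nhds
    (ChartedSpace.mem_chart_source x))] with q hq
  have h1 := congrArg (fun u : E => (q.2 : E →L[ℂ] ℂ) u) (sum_coeffFun_smul b v hq)
  refine Eq.trans ?_ h1.symm
  refine Eq.trans ?_ (map_sum (q.2 : E →L[ℂ] ℂ) _ _).symm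
  exact Finset.sum_congr rfl fun i _ => (map_smul (q.2 : E →L[ℂ] ℂ) _ _).symm

end CotangentBundle

/-! ### Regular sequences of symbols and of operators -/

section Comparison

theorem mem_ideal_span_image_Iio {R : Type*} [Semiring R] (w : ℕ → R) (d : ℕ) (x : R) :
    x ∈ Ideal.span (w '' Set.Iio d) ↔
      ∃ c : ℕ → R, x = ∑ j ∈ Finset.range d, c j * w j := by
  rw [Ideal.span, ← Finset.coe_range, Submodule.mem_span_image_finset_iff_exists_fun']
  simp only [smul_eq_mul, eq_comm]

/-- Unwinds injectivity on the quotient by a list prefix into a statement about explicit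
combinations, the form `gradedRegular` takes as input. -/
theorem IsWeaklyRegular.exists_sum_eq {R : Type*} [CommRing R] {r : ℕ} {w : ℕ → R}
    (h : RingTheory.Sequence.IsWeaklyRegular R (List.ofFn fun i : Fin r => w i)) {d : ℕ}
    (hd : d < r) {y : R} {c : ℕ → R} (hy : y * w d = ∑ j ∈ Finset.range d, c j * w j) :
    ∃ c' : ℕ → R, y = ∑ j ∈ Finset.range d, c' j * w j := by
  have h1 := h.regular_mod_prev d (by simpa using hd)
  have hspan : Ideal.ofList ((List.ofFn fun i : Fin r => w i).take d) =
      Ideal.span (w '' Set.Iio d) := by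
    refine congrArg Ideal.span (Set.ext fun s => ?_)
    simp only [mem_ofPred_eq, List.mem_take_iff_getElem, List.length_ofFn, List.getElem_ofFn,
      mem_image, mem_Iio]
    constructor
    · rintro ⟨j, hj, rfl⟩
      exact ⟨j, hj.trans_le (min_le_left _ _), rfl⟩
    · rintro ⟨j, hj, rfl⟩
      exact ⟨j, lt_min hj (hj.trans hd), rfl⟩
  rw [isSMulRegular_quotient_iff_mem_of_smul_mem] at h1
  simp only [hspan, smul_eq_mul, Ideal.mul_top, List.getElem_ofFn] at h1
  refine (mem_ideal_span_image_Iio w d y).1 (h1 y ?_)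
  rw [mul_comm]
  exact (mem_ideal_span_image_Iio w d _).2 ⟨c, hy⟩

/-- Commuting operators with a regular sequence of symbols form a regular sequence for right
multiplication. -/
theorem IsCoordinateSystem.mem_span_of_mul_mem {K A ι : Type*} [Field K] [CharZero K] [CommRing A]
    [Algebra K A] [DecidableEq ι] [Fintype ι] {D : ι → Derivation K A A} {z : ι → A}
    (h : IsCoordinateSystem D z) {𝒟 : Subalgebra K (Module.End K A)}
    (h1 : ∀ p, h.quantize p ∈ 𝒟) (h2 : ∀ T ∈ 𝒟, ∃ p, h.quantize p = T) {v : ℕ → 𝒟}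
    {a : ℕ → ι → A} {r : ℕ} (hv : ∀ j, (v j : Module.End K A) = fieldOperator D (a j))
    (hcomm : ∀ i j, v i * v j = v j * v i) (ha : GradedRegular a r) {d : ℕ} (hd : d < r) {P : 𝒟}
    (hP : P * v d ∈ Ideal.span (v '' Set.Iio d)) : P ∈ Ideal.span (v '' Set.Iio d) := by
  rw [mem_ideal_span_image_Iio] at hP ⊢
  obtain ⟨c, hc⟩ := hP
  exact (h.symbolRegularFiltration h1 h2 hv hcomm ha).exists_of_mul_eq hd hc

variable {E X : Type*} [NormedAddCommGroup E] [NormedSpace ℂ E]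
  [TopologicalSpace X] [ChartedSpace E X] [IsManifold 𝓘(ℂ, E) ω X]

theorem holVFieldAt_zero (x : X) : HolVFieldAt (E := E) (fun _ : X => 0) x :=
  Bundle.contMDiff_zeroSection ℂ (TangentSpace 𝓘(ℂ, E) : X → Type _) x

/-- Commuting vector fields whose symbols form a regular sequence form a regular sequence of
differential operators. -/
theorem operatorsRegular_of_symbolsRegular [CompleteSpace E] {ι : Type*} [Fintype ι]
    [DecidableEq ι] (b : Module.Basis ι ℂ E) {U : TopologicalSpace.Opens X} {r : ℕ}
    {v : Fin r → VField E X} (hv : ∀ i, ∀ x ∈ U, HolVFieldAt (v i) x)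
    (hcomm : ∀ i j, ∀ x ∈ U, VectorField.mlieBracket 𝓘(ℂ, E) (v i) (v j) x = 0)
    (hreg : SymbolsRegular U v hv) : OperatorsRegular U v hv := by
  intro x hx d P hP
  -- extend the family by zero
  let w : ℕ → VField E X := fun j => if h : j < r then v ⟨j, h⟩ else fun _ => 0
  have hwv : ∀ i : Fin r, w i = v i := fun i => dif_pos i.2
  have hw : ∀ j, HolVFieldAt (w j) x := fun j => by
    by_cases h : j < r
    · simp only [w, dif_pos h]
      exact hv _ x hx
    · simp only [w, dif_neg h]
      exact holVFieldAt_zero x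
  have hwcomm : ∀ i j, ∀ y ∈ U, VectorField.mlieBracket 𝓘(ℂ, E) (w i) (w j) y = 0 := by
    intro i j y hy
    by_cases hi : i < r
    · by_cases hj : j < r
      · simp only [w, dif_pos hi, dif_pos hj]
        exact hcomm _ _ y hy
      · simp only [w, dif_neg hj]
        exact congrFun VectorField.mlieBracket_zero_right y
    · simp only [w, dif_neg hi]
      exact congrFun VectorField.mlieBracket_zero_left y
  have hspan : (fun j => vfieldOp (v j) (hv j x hx)) '' Set.Iio d =
      (fun j => vfieldOp (w j) (hw j)) '' Set.Iio (d : ℕ) := by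
    ext T
    constructor
    · rintro ⟨j, hj, rfl⟩
      exact ⟨j, hj, by simp only [hwv]⟩
    · rintro ⟨j, hj, rfl⟩
      exact ⟨⟨j, hj.trans d.2⟩, hj, by simp only [← hwv]⟩
  have hd : vfieldOp (v d) (hv d x hx) = vfieldOp (w d) (hw d) := by simp only [hwv]
  have hsys := isCoordinateSystem b x
  have hgraded : IsCoordinateSystem.GradedRegular (fun j => coeffGerm b (hw j)) r := by
    refine (isFibreSystem b x).gradedRegular ℂ (polynomialMap b x) (chartMap x)
      (fun s => ?_) (fun i => ?_) ?_
    · simp only [polynomialMap, MvPolynomial.coe_eval₂Hom, MvPolynomial.eval₂_C]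
      exact chartMap_projMap x s
    · simp only [polynomialMap, MvPolynomial.coe_eval₂Hom, MvPolynomial.eval₂_X]
      exact chartMap_symbol_coordField b x i
    · intro d hd y c hy
      refine IsWeaklyRegular.exists_sum_eq (r := r)
        (w := fun j => polynomialMap b x (linearForm (coeffGerm b (hw j)))) ?_ hd hy
      -- Fibrewise Taylor expansion is made at the zero covector, so regularity is invoked at this
      -- point of the fibre.
      have := hreg (zeroCovector x) hx
      convert this using 3 with i
      rw [polynomialMap_linearForm]
      simp only [hwv]
  rw [hspan, hd] at hP
  rw [hspan]
  exact hsys.mem_span_of_mul_mem (𝒟 := DiffOp (E := E) x)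
    (v := fun j => vfieldOp (w j) (hw j)) (a := fun j => coeffGerm b (hw j)) (r := r)
    (hsys.quantize_mem_adjoin fun i => ⟨coordField b x i, holVFieldAt_coordField b x i, rfl⟩)
    (fun T hT => hsys.exists_quantize_of_mem_adjoin (by
      rintro _ ⟨u, hu, rfl⟩
      exact ⟨_, vfieldEnd_eq_fieldOperator b hu⟩) hT)
    (fun j => vfieldEnd_eq_fieldOperator b (hw j))
    (fun i j => Subtype.ext (vfieldEnd_commute (hw i) (hw j)
      (Filter.mem_of_superset (U.isOpen.mem_nhds hx) (hwcomm i j)))) hgraded d.2 hP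

end Comparison

end HolFoliation

end

theorem mainTheorem3 (n : ℕ) (X : Type*) [TopologicalSpace X]
    [ChartedSpace (EuclideanSpace ℂ (Fin n)) X]
    [IsManifold 𝓘(ℂ, EuclideanSpace ℂ (Fin n)) ω X]
    (I : HolFoliation.VFieldSubmodule (EuclideanSpace ℂ (Fin n)) X) (hI : I.IsFoliation) :
    (∀ (U : TopologicalSpace.Opens X) (r : ℕ)
        (v : Fin r → HolFoliation.VField (EuclideanSpace ℂ (Fin n)) X)
        (h : I.CommutingGenerators U v),
        HolFoliation.SymbolsRegular U v h.hol → HolFoliation.OperatorsRegular U v h.hol) ∧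
      (I.LocallySymbolRegular → I.LocallyOperatorRegular) := by
  have key : ∀ (U : TopologicalSpace.Opens X) (r : ℕ)
      (v : Fin r → HolFoliation.VField (EuclideanSpace ℂ (Fin n)) X)
      (h : I.CommutingGenerators U v),
      HolFoliation.SymbolsRegular U v h.hol → HolFoliation.OperatorsRegular U v h.hol :=
    fun U r v h => HolFoliation.operatorsRegular_of_symbolsRegular
      (EuclideanSpace.basisFun (Fin n) ℂ).toBasis h.hol h.comm
  refine ⟨key, fun h x => ?_⟩
  obtain ⟨U, hx, r, v, hv, hreg⟩ := h x
  exact ⟨U, hx, r, v, hv, key U r v hv hreg⟩
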